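/- **Conventions.** Curves are connected and projective over $\mathbb{C}$. A nilpotent orbit $O$ of $\mathfrak{sl}(N)$ is labelled by the partition $p_1\ge p_2\ge\cdots$ of $N$ given by its Jordan block sizes (with $p_i=0$ when there are no more parts). Its vanishing order $\chi_k(O)$, $1\le k\le N$, is the least $c$ with $p_1+\dots+p_c\ge k$. A tame $SL_N$ Hitchin system (with nilpotent residues) is given by a smooth curve $C$ of genus $g$ with distinct marked points $x_i$, $i \in I$ ($I$ finite), and a nonzero nilpotent orbit $O_i$ of $\mathfrak{sl}(N)$ for each $i$. Put $D=\sum_i x_i$ and, for $k=2,\dots,N$, $\mathcal L_k=(K_C(D))^{\otimes k}\otimes\mathcal O(-\sum_i\chi_k(O_i)\,x_i)$. The system is *OK* if $H^1(C,\mathcal L_k)=0$ for all $k=2,\dots,N$. Consider a degeneration of $C$ to a stable marked curve $C_0$ with exactly one node $p$, of the same arithmetic genus and with the same orbits at the marked points; $\mathcal L_k$ on $C_0$ is given by the same formula, with $K_{C_0}$ the dualizing sheaf. *Separating node.* Let $C_L,C_R$ be the two smooth components. Let $n_k^L\ge0$ be the least integer with $H^1(C_L,\mathcal L_k|_{C_L}(n_k^L\,p))=0$,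 define $n_k^R$ likewise, and put $n_k=n_k^L+n_k^R$ (for an OK system at most one summand is nonzero). Let $\mathcal L_k'$ be the line bundle on $C_0$ that restricts to $\mathcal L_k|_{C_L}((n_k^L-n_k^R)p)$ on $C_L$ and to $\mathcal L_k|_{C_R}((n_k^R-n_k^L)p)$ on $C_R$. Put $$b_k^C=\dim\; H^0(C_0,\mathcal L_k')\big/\bigl(H^0(C_L,\mathcal L_k'|_{C_L}(-p))\oplus H^0(C_R,\mathcal L'_k|_{C_R}(-p))\bigr).$$ *Non-separating node.* Let $\nu:\tilde C\to C_0$ be the normalization and $\nu^{-1}(p)=\{q_1,q_2\}$. Put $n_k=0$ and $b_k^C=\dim H^0(C_0,\mathcal L_k)/H^0(\tilde C,\nu^*\mathcal L_k(-q_1-q_2))$. The node is *restricted* if $b_k^C=0$ for some $k\in\{2,\dots,N\}$. Write $b^C=\sum_{k=2}^N b_k^C$. **Theorem.** Suppose the tame $SL_N$ Hitchin system is OK and the node of $C_0$ is restricted. Then there is a nilpotent orbit $O$ of $\mathfrak{sl}(N)$, with partition $p_1\ge p_2\ge\cdots$, such that: (A) $\chi_k(O)=1+n_k$ for all $k=2,\dots,N$;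 (B) there is $m\in\{2,\dots,N\}$ such that $(b_2^C,\dots,b_N^C)$ is either of the form $(1,\dots,1,0,\dots,0)$, that is, $b_k^C=1$ for $k\le m$ and $b_k^C=0$ for $k>m$; or of the alternating form $(1,0,1,0,\dots,1,0,\dots,0)$, that is, $b_k^C=1$ if $k$ is even and $k\le m$, and $b_k^C=0$ otherwise; (C) $p_1\ge 2p_2$ and $p_1-2\le 2b^C\le 2(p_1-p_2-1)$. -/

import Mathlib

universe u

noncomputable section

namespace TameHitchin

/-! ### Nilpotent orbits of `sl(N)` and their vanishing orders -/

/-- Nilpotent orbits of `sl(N)` are labelled by partitions of `N` (sizes of the Jordan blocks).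
`part O i` is the `(i+1)`-st largest part (so `part O 0 ≥ part O 1 ≥ ⋯`), and `0` when there are
no more parts. -/
def part {N : ℕ} (O : Nat.Partition N) (i : ℕ) : ℕ :=
  (O.parts.sort (· ≥ ·)).getD i 0

/-- The vanishing order `χ_k` of the orbit `O`: draw the Young diagram whose columns have the parts
of `O` as heights, number the boxes consecutively down the first column, then down the second, and
so on; `χ_k` is the number of the column that contains the `k`-th box (for `1 ≤ k ≤ N`). -/
def vanishingOrder {N : ℕ} (O : Nat.Partition N) (k : ℕ) : ℕ :=
  sInf {c : ℕ | k ≤ ∑ i ∈ Finset.range c, part O i}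

/-- The orbit is not the zero orbit `[1, 1, …, 1]`. -/
def IsNonzeroOrbit {N : ℕ} (O : Nat.Partition N) : Prop :=
  2 ≤ part O 0

/-! ### Smooth projective curves over `ℂ`, through their function fields -/

/-- `F` is the function field of a smooth connected projective curve over `ℂ`: a finite extension
of `ℂ(x)` with `x` transcendental over `ℂ`. -/
class IsFunctionField (F : Type u) [Field F] [Algebra ℂ F] : Prop where
  exists_transcendental : ∃ x : F, Transcendental ℂ x ∧
    FiniteDimensional (IntermediateField.adjoin ℂ {x}) F

/-- A point of the curve: a normalized discrete valuation of the function field, trivial on `ℂ`.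
It is written multiplicatively, so that `val f = WithZero.exp (-n)` when `f` vanishes to
order `n` at the point. -/
structure Place (F : Type u) [Field F] [Algebra ℂ F] where
  val : Valuation F (WithZero (Multiplicative ℤ))
  val_algebraMap : ∀ c : ℂ, c ≠ 0 → val (algebraMap ℂ F c) = 1
  surjective : Function.Surjective val

/-- Divisors on the curve. The line bundle `𝒪(D)` is represented by the divisor `D`. -/
abbrev Divisor (F : Type u) [Field F] [Algebra ℂ F] : Type u := Place F →₀ ℤ

section Cohomology

variable {F : Type u} [Field F] [Algebra ℂ F]

/-- The prime divisor of a point. -/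
def Place.divisor (P : Place F) : Divisor F := Finsupp.single P 1

/-- Rational functions with at most a pole of order `n` at `P` (a zero of order `-n` if `n < 0`):
the stalk at `P` of `𝒪(D)` when `n = D P`. -/
def stalk (P : Place F) (n : ℤ) : Submodule ℂ F where
  carrier := {f | P.val f ≤ WithZero.exp n}
  add_mem' {a b} ha hb := (P.val.map_add a b).trans (max_le ha hb)
  zero_mem' := by simp
  smul_mem' c f hf := by
    rcases eq_or_ne c 0 with rfl | hc
    · simp
    · simpa [Algebra.smul_def, P.val_algebraMap c hc] using hf

/-- The fibre at `P` of a line bundle `𝒪(D)` with `D P = n`. -/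
abbrev Fiber (P : Place F) (n : ℤ) : Type u :=
  stalk P n ⧸ (stalk P (n - 1)).comap (stalk P n).subtype

/-- Global sections `H⁰(𝒪(D))`. -/
def H0 (D : Divisor F) : Submodule ℂ F := ⨅ P : Place F, stalk P (D P)

/-- The value at `P` of a global section. -/
def evalAt (D : Divisor F) (P : Place F) : H0 D →ₗ[ℂ] Fiber P (D P) :=
  Submodule.mkQ _ ∘ₗ Submodule.inclusion (iInf_le (fun Q : Place F => stalk Q (D Q)) P)

variable (F) in
/-- Repartitions (adeles): families of rational functions indexed by the points of the curve,
regular at the point for almost every point. -/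
def repartitions : Submodule ℂ (Place F → F) where
  carrier := {α | {P : Place F | ¬ α P ∈ stalk P 0}.Finite}
  add_mem' {a b} ha hb := (ha.union hb).subset fun P hP => by
    by_cases h : a P ∈ stalk P 0
    · exact Or.inr fun h' => hP ((stalk P 0).add_mem h h')
    · exact Or.inl h
  zero_mem' := Set.finite_empty.subset fun P hP => hP (stalk P 0).zero_mem
  smul_mem' c a ha := Set.Finite.subset ha fun P hP h => hP ((stalk P 0).smul_mem c h)

/-- Repartitions bounded by `D`. -/
def boundedRepartitions (D : Divisor F) : Submodule ℂ (Place F → F) :=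
  Submodule.pi Set.univ fun P => stalk P (D P)

variable (F) in
/-- The function field, embedded diagonally. -/
def principalRepartitions : Submodule ℂ (Place F → F) :=
  LinearMap.range (LinearMap.pi fun _ : Place F => (LinearMap.id : F →ₗ[ℂ] F))

/-- First cohomology `H¹(𝒪(D))`: repartitions modulo bounded and principal ones. -/
abbrev H1 (D : Divisor F) : Type u :=
  repartitions F ⧸
    (boundedRepartitions D ⊔ principalRepartitions F).comap (repartitions F).subtype

variable (F) in
/-- The genus `h¹(𝒪)`. -/
def genus : ℕ := Module.finrank ℂ (H1 (0 : Divisor F))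

/-- `W` is a canonical divisor, i.e. `𝒪(W)` is the canonical line bundle (dualizing sheaf) `K`:
it is the divisor of a nonzero Weil differential `ω`, a linear form on the repartitions that
vanishes on the principal ones; its divisor is the largest `D` such that `ω` vanishes on the
repartitions bounded by `D`. -/
def IsCanonical (W : Divisor F) : Prop :=
  ∃ ω : repartitions F →ₗ[ℂ] ℂ, ω ≠ 0 ∧
    (∀ α : repartitions F, (α : Place F → F) ∈ principalRepartitions F → ω α = 0) ∧
    ∀ D : Divisor F,
      (∀ α : repartitions F, (α : Place F → F) ∈ boundedRepartitions D → ω α = 0) ↔ D ≤ W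

end Cohomology

/-! ### Tame Hitchin systems on smooth curves -/

/-- A smooth projective curve with finitely many distinct marked points and, at each of them, the
nonzero nilpotent orbit that contains the residue of the Higgs field. A canonical divisor is
chosen to represent the canonical bundle. These are the data of a tame `SL_N` Hitchin system
with nilpotent residues. -/
structure MarkedCurve (N : ℕ) : Type (u + 1) where
  /-- the function field of the curve -/
  K : Type u
  [field : Field K]
  [algebra : Algebra ℂ K]
  [isFunctionField : IsFunctionField K]
  /-- a canonical divisor -/
  W : Divisor K
  isCanonical : IsCanonical W
  /-- labels of the marked points -/
  ι : Type
  [fintype : Fintype ι]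
  point : ι → Place K
  point_injective : Function.Injective point
  orbit : ι → Nat.Partition N
  orbit_nonzero : ∀ i, IsNonzeroOrbit (orbit i)

attribute [instance] MarkedCurve.field MarkedCurve.algebra MarkedCurve.isFunctionField
  MarkedCurve.fintype

namespace MarkedCurve

variable {N : ℕ} (X : MarkedCurve.{u} N)

/-- The line bundle `(K(E + D))^{⊗ k} ⊗ 𝒪(-∑ χ_k^{(i)} p_i)`, where `D = ∑ p_i` is the divisor of
marked points and `E` is a further divisor (the points over the node, if there is one). -/
def twistedBundle (E : Divisor X.K) (k : ℕ) : Divisor X.K :=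
  k • (X.W + E + ∑ i, (X.point i).divisor) -
    ∑ i, vanishingOrder (X.orbit i) k • (X.point i).divisor

/-- The line bundle `L_k` whose sections are the degree `k` coefficients of the spectral curve. -/
def L (k : ℕ) : Divisor X.K := X.twistedBundle 0 k

/-- The tame Hitchin system on the smooth marked curve is OK: `H¹(C, L_k) = 0` for all degrees `k`
of invariant polynomials. -/
def IsOK : Prop := ∀ k ∈ Finset.Icc 2 N, Subsingleton (H1 (X.L k))

end MarkedCurve

/-! ### Separating nodes -/

/-- A stable marked curve with one node, which is separating: two smooth marked curves joined at
a point of each, distinct from the marked points. -/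
structure SeparatingCurve (N : ℕ) : Type (u + 1) where
  left : MarkedCurve.{u} N
  right : MarkedCurve.{u} N
  pL : Place left.K
  pR : Place right.K
  pL_not_marked : ∀ i, left.point i ≠ pL
  pR_not_marked : ∀ i, right.point i ≠ pR
  left_stable : 0 < 2 * (genus left.K : ℤ) - 2 + (Fintype.card left.ι + 1)
  right_stable : 0 < 2 * (genus right.K : ℤ) - 2 + (Fintype.card right.ι + 1)

namespace SeparatingCurve

variable {N : ℕ} (C : SeparatingCurve.{u} N)

/-- The restriction of `L_k` to the left component. The canonical bundle of the nodal curve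
restricts to the canonical bundle of the component with a simple pole allowed at the node. -/
def bundleL (k : ℕ) : Divisor C.left.K := C.left.twistedBundle C.pL.divisor k

/-- The restriction of `L_k` to the right component. -/
def bundleR (k : ℕ) : Divisor C.right.K := C.right.twistedBundle C.pR.divisor k

/-- `n_k^L`: the smallest `n ≥ 0` such that `H¹(C_L, L_k ⊗ 𝒪(n p)) = 0`. -/
def nL (k : ℕ) : ℕ := sInf {n : ℕ | Subsingleton (H1 (C.bundleL k + n • C.pL.divisor))}

/-- `n_k^R`: the smallest `n ≥ 0` such that `H¹(C_R, L_k ⊗ 𝒪(n p)) = 0`. -/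
def nR (k : ℕ) : ℕ := sInf {n : ℕ | Subsingleton (H1 (C.bundleR k + n • C.pR.divisor))}

/-- The restriction to the left component of the twist
`L'_k = L_k ⊗ 𝒪(-n_k^L 𝒞_L - n_k^R 𝒞_R)`, where `𝒪(-𝒞_L)` restricts to `𝒪(p)` on the left and to
`𝒪(-p)` on the right component, and `𝒪(-𝒞_R)` the other way round. -/
def bundleL' (k : ℕ) : Divisor C.left.K :=
  C.bundleL k + ((C.nL k : ℤ) - C.nR k) • C.pL.divisor

/-- The restriction of `L'_k` to the right component. -/
def bundleR' (k : ℕ) : Divisor C.right.K :=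
  C.bundleR k + ((C.nR k : ℤ) - C.nL k) • C.pR.divisor

end SeparatingCurve

/-- A separating node together with the line bundles `L'_k` on the nodal curve: a line bundle on the
nodal curve is a line bundle on each component and an identification of their fibres over the
node. -/
structure SeparatingNode (N : ℕ) : Type (u + 1) extends SeparatingCurve.{u} N where
  gluing : ∀ k : ℕ, Fiber pL (toSeparatingCurve.bundleL' k pL) ≃ₗ[ℂ]
    Fiber pR (toSeparatingCurve.bundleR' k pR)

namespace SeparatingNode

variable {N : ℕ} (C : SeparatingNode.{u} N)

/-- The degree `k` part `H⁰(C, L'_k)` of the Hitchin base: pairs of sections on the two components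
that agree at the node. -/
def base (k : ℕ) : Submodule ℂ (C.left.K × C.right.K) :=
  (LinearMap.eqLocus
    ((C.gluing k).toLinearMap ∘ₗ evalAt (C.bundleL' k) C.pL ∘ₗ LinearMap.fst ℂ _ _)
    (evalAt (C.bundleR' k) C.pR ∘ₗ LinearMap.snd ℂ _ _)).map
      ((H0 (C.bundleL' k)).subtype.prodMap (H0 (C.bundleR' k)).subtype)

/-- The degree `k` part `H⁰(L'_k ⊗ 𝒪_{C_L}(-p)) ⊕ H⁰(L'_k ⊗ 𝒪_{C_R}(-p))` of `B_L ⊕ B_R`. -/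
def splitBase (k : ℕ) : Submodule ℂ (C.left.K × C.right.K) :=
  (H0 (C.bundleL' k - C.pL.divisor)).prod (H0 (C.bundleR' k - C.pR.divisor))

/-- The graded dimension `b_k^C` of the space of center parameters `B_C = B / (B_L ⊕ B_R)`. -/
def centerDim (k : ℕ) : ℕ :=
  Module.finrank ℂ (C.base k ⧸ (C.splitBase k).comap (C.base k).subtype)

/-- The twist `n_k` at the node (when the system is OK, at most one of the two summands is
nonzero). -/
def twist (k : ℕ) : ℕ := C.nL k + C.nR k

/-- The nodal curve is a degeneration of smooth marked curves such as `H`: the genus is the same,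
and the marked points of `H` are distributed over the two components. -/
def IsDegenerationOf (H : MarkedCurve.{u} N) : Prop :=
  genus H.K = genus C.left.K + genus C.right.K ∧
    ∃ e : H.ι ≃ C.left.ι ⊕ C.right.ι, ∀ i, H.orbit i = Sum.elim C.left.orbit C.right.orbit (e i)

end SeparatingNode

/-! ### Non-separating nodes -/

/-- A stable marked curve with one node, which is non-separating: the points `q₁ ≠ q₂` of a smooth
marked curve are identified. The line bundles `L_k` come with an identification of their fibres
over `q₁` and `q₂`. -/
structure NonseparatingNode (N : ℕ) : Type (u + 1) where
  normalization : MarkedCurve.{u} N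
  q₁ : Place normalization.K
  q₂ : Place normalization.K
  q_ne : q₁ ≠ q₂
  q₁_not_marked : ∀ i, normalization.point i ≠ q₁
  q₂_not_marked : ∀ i, normalization.point i ≠ q₂
  stable : 0 < 2 * (genus normalization.K : ℤ) - 2 + (Fintype.card normalization.ι + 2)
  gluing : ∀ k : ℕ,
    Fiber q₁ (normalization.twistedBundle (q₁.divisor + q₂.divisor) k q₁) ≃ₗ[ℂ]
      Fiber q₂ (normalization.twistedBundle (q₁.divisor + q₂.divisor) k q₂)

namespace NonseparatingNode

variable {N : ℕ} (C : NonseparatingNode.{u} N)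

/-- The pullback of `L_k` to the normalization. -/
def bundle (k : ℕ) : Divisor C.normalization.K :=
  C.normalization.twistedBundle (C.q₁.divisor + C.q₂.divisor) k

/-- The degree `k` part `H⁰(C, L_k)` of the Hitchin base. -/
def base (k : ℕ) : Submodule ℂ C.normalization.K :=
  (LinearMap.eqLocus ((C.gluing k).toLinearMap ∘ₗ evalAt (C.bundle k) C.q₁)
    (evalAt (C.bundle k) C.q₂)).map (H0 (C.bundle k)).subtype

/-- The degree `k` part `H⁰(L_k(-q₁ - q₂))` of the Hitchin base of the normalization. -/
def normalizationBase (k : ℕ) : Submodule ℂ C.normalization.K :=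
  H0 (C.bundle k - C.q₁.divisor - C.q₂.divisor)

/-- The graded dimension `b_k^C` of the space of center parameters. -/
def centerDim (k : ℕ) : ℕ :=
  Module.finrank ℂ (C.base k ⧸ (C.normalizationBase k).comap (C.base k).subtype)

/-- The nodal curve is a degeneration of smooth marked curves such as `H`. -/
def IsDegenerationOf (H : MarkedCurve.{u} N) : Prop :=
  genus H.K = genus C.normalization.K + 1 ∧
    ∃ e : H.ι ≃ C.normalization.ι, ∀ i, H.orbit i = C.normalization.orbit (e i)

end NonseparatingNode

/-! ### Nodes -/

/-- A stable marked curve with exactly one node. -/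
inductive Node (N : ℕ) : Type (u + 1) where
  | separating (C : SeparatingNode.{u} N) : Node N
  | nonseparating (C : NonseparatingNode.{u} N) : Node N

namespace Node

variable {N : ℕ}

/-- The graded dimension `b_k^C` of the space of center parameters at the node. -/
def centerDim : Node.{u} N → ℕ → ℕ
  | separating C => C.centerDim
  | nonseparating C => C.centerDim

/-- The twist `n_k` at the node; there is no twist at a non-separating node. -/
def twist : Node.{u} N → ℕ → ℕ
  | separating C => C.twist
  | nonseparating _ => 0

/-- The nodal curve is a degeneration of smooth marked curves such as `H`, with the same genus and
the same orbits at the marked points. -/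
def IsDegenerationOf : Node.{u} N → MarkedCurve.{u} N → Prop
  | separating C => C.IsDegenerationOf
  | nonseparating C => C.IsDegenerationOf

/-- The node is restricted: some `b_k^C` vanishes, `2 ≤ k ≤ N`. -/
def IsRestricted (C : Node.{u} N) : Prop :=
  ∃ k ∈ Finset.Icc 2 N, C.centerDim k = 0

end Node

end TameHitchin

end

/-! At a separating node everything is read off from degrees, one component at a time. Nonzero
orbits satisfy `χ_k < k`, so on a component of positive genus the bundle `L_k(-p)` has degree above
`2g - 2`, its `H¹` vanishes, and that component imposes no condition. On a rational component the
restriction of `L_k` has degree `d_k = ∑ (k - χ_k(O_i)) - k`, and `H¹` vanishes exactly in degrees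
at least `-1`, so its twist is `max(0, -1 - d_k)`. If both degrees are nonnegative, sections take
any value at the node and `b_k = 1`. If one of them is negative, the twisted bundle on that side has
degree `-1`, hence no sections, and `b_k = 0` (`SeparatingNode.centerDim_eq`). The OK condition is
needed when both components are rational: it says that the two degrees add up to at least `-1`. At a
non-separating node the same estimate gives `b_k = 1` for every `k`, so such a node is never
restricted.

What remains is combinatorics of partitions (`exists_restrictedShape`). As `k` grows by one, `d_k`
drops by at most one, and it drops exactly when every `χ_k(O_i)` jumps. Let `t + 1` be the first
degree with `d < 0`. Then `d_t = 0`, and for every `i` the first `t` boxes of `O_i` fill exactly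
`c_i` columns, with `∑ (t - c_i) = t`. If at most one orbit `O_j` has a next column of height at
least `2`, all others contribute constants from then on. Merging the first `c_j + 1` columns of
`O_j` into one gives the orbit sought, and `b` is `(1, …, 1, 0, …, 0)`. If two orbits have such a
column, counting boxes forces exactly two marked points whose orbits have all parts at most `2`;
then `d` alternates between `0` and `-1`, which gives the alternating form.

If both components have negative degrees somewhere, the inequality for the sum excludes all but one
combination, in which no twist occurs and the orbit is the single block (`hasNodeOrbit_of_degrees`).

Since genus, `H¹` and canonical divisors are defined by repartitions, Riemann–Roch and Serre duality
are proved first, by Weil's method: finiteness of `H¹` comes from strong approximation, and duality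
from the fact that Weil differentials form a one-dimensional space over the function field. -/

noncomputable section

namespace TameHitchin

open IntermediateField Polynomial
open IsDedekindDomain (HeightOneSpectrum)

/-! ### Valuations of the function field and their residue field. -/

section Places

variable {F : Type u} [Field F] [Algebra ℂ F]

theorem Place.ext_val {P Q : Place F} (h : P.val = Q.val) : P = Q := by
  cases P; cases Q; congr

theorem Place.val_algebraMap_le_one (P : Place F) (c : ℂ) : P.val (algebraMap ℂ F c) ≤ 1 := by
  rcases eq_or_ne c 0 with rfl | hc
  · simp
  · rw [P.val_algebraMap c hc]

theorem mem_stalk {P : Place F} {n : ℤ} {f : F} : f ∈ stalk P n ↔ P.val f ≤ WithZero.exp n :=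
  Iff.rfl

theorem mem_stalk_zero {P : Place F} {f : F} : f ∈ stalk P 0 ↔ P.val f ≤ 1 := by
  rw [mem_stalk, WithZero.exp_zero]

theorem stalk_mono (P : Place F) {m n : ℤ} (h : m ≤ n) : stalk P m ≤ stalk P n := fun _ hf =>
  le_trans (b := WithZero.exp m) hf (WithZero.exp_le_exp.2 h)

theorem Place.exists_val_eq (P : Place F) (n : ℤ) : ∃ g : F, P.val g = WithZero.exp n :=
  P.surjective _

theorem Place.ne_zero_of_val_eq_exp (P : Place F) {g : F} {n : ℤ} (h : P.val g = WithZero.exp n) :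
    g ≠ 0 :=
  (Valuation.ne_zero_iff P.val).1 (h ▸ WithZero.exp_ne_zero)

theorem Place.val_le_exp_sub_one (P : Place F) {f : F} {n : ℤ} (h : P.val f < WithZero.exp n) :
    P.val f ≤ WithZero.exp (n - 1) := by
  rcases eq_or_ne (P.val f) 0 with h0 | h0
  · simp [h0]
  · rw [← WithZero.exp_log h0] at h ⊢
    rw [WithZero.exp_lt_exp] at h
    rw [WithZero.exp_le_exp]
    omega

theorem Place.val_aeval_le_one (P : Place F) {x : F} (hx : P.val x ≤ 1) (p : ℂ[X]) :
    P.val (aeval x p) ≤ 1 := by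
  induction p using Polynomial.induction_on' with
  | add p q hp hq => rw [map_add]; exact (P.val.map_add _ _).trans (max_le hp hq)
  | monomial n a =>
    rw [aeval_monomial, map_mul, map_pow]
    exact mul_le_one' (P.val_algebraMap_le_one a) (pow_le_one₀ zero_le hx)

/-- At a pole of `x` the leading term strictly dominates the rest of the polynomial. -/
theorem Place.val_aeval_of_one_lt (P : Place F) {x : F} (hx : 1 < P.val x) {p : ℂ[X]}
    (hp : p ≠ 0) : P.val (aeval x p) = P.val x ^ p.natDegree := by
  induction hn : p.natDegree using Nat.strong_induction_on generalizing p with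
  | _ n ih =>
    have hlead : P.val (aeval x (monomial n p.leadingCoeff)) = P.val x ^ n := by
      rw [aeval_monomial, map_mul, map_pow, P.val_algebraMap _ (leadingCoeff_ne_zero.2 hp), one_mul]
    have hsplit : aeval x p = aeval x p.eraseLead + aeval x (monomial n p.leadingCoeff) := by
      rw [← map_add, ← hn, eraseLead_add_monomial_natDegree_leadingCoeff]
    rcases eq_or_ne p.eraseLead 0 with h0 | h0
    · rw [hsplit, h0, map_zero, zero_add, hlead]
    · have hlt : p.eraseLead.natDegree < n := by
        rw [← hn]
        refine (eraseLead_natDegree_lt_or_eraseLead_eq_zero p).resolve_right h0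
      rw [hsplit, P.val.map_add_eq_of_lt_right, hlead]
      rw [hlead, ih _ hlt h0 rfl]
      exact pow_lt_pow_right₀ hx hlt

theorem transcendental_of_notMem_range {x : F} (hx : ∀ c : ℂ, algebraMap ℂ F c ≠ x) :
    Transcendental ℂ x := by
  rintro ⟨p, hp, h0⟩
  rw [(IsAlgClosed.splits p).eq_prod_roots, map_mul, aeval_C, map_multiset_prod] at h0
  rcases mul_eq_zero.1 h0 with h | h
  · exact hp (leadingCoeff_eq_zero.1 ((map_eq_zero _).1 h))
  · rw [Multiset.prod_eq_zero_iff] at h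
    simp only [Multiset.map_map, Multiset.mem_map, Function.comp_apply] at h
    obtain ⟨c, -, hc⟩ := h
    have hxc : x - algebraMap ℂ F c = 0 := by simpa using hc
    exact hx c (sub_eq_zero.1 hxc).symm

section FunctionField

variable [IsFunctionField F]

/-- The definition of a function field provides one such element; every transcendental element
works, because the transcendence degree is one. -/
theorem finiteDimensional_adjoin {y : F} (hy : Transcendental ℂ y) :
    FiniteDimensional ℂ⟮y⟯ F := by
  obtain ⟨x, hx, hfin⟩ := IsFunctionField.exists_transcendental (F := F)
  let e := RatFunc.algEquivOfTranscendental x hx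
  let : Algebra (RatFunc ℂ) F := ((ℂ⟮x⟯.val).comp e.toAlgHom).toRingHom.toAlgebra
  have : IsScalarTower ℂ (RatFunc ℂ) F :=
    IsScalarTower.of_algebraMap_eq fun c => (((ℂ⟮x⟯.val).comp e.toAlgHom).commutes c).symm
  have : FunctionField ℂ F := by
    let : Algebra (RatFunc ℂ) ℂ⟮x⟯ := e.toAlgHom.toRingHom.toAlgebra
    have : IsScalarTower (RatFunc ℂ) ℂ⟮x⟯ F := IsScalarTower.of_algebraMap_eq fun c => rfl
    have : Module.Finite (RatFunc ℂ) ℂ⟮x⟯ :=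
      Module.Finite.of_surjective (Algebra.linearMap (RatFunc ℂ) ℂ⟮x⟯) e.surjective
    exact Module.Finite.trans ℂ⟮x⟯ F
  exact FunctionField.finiteDimensional_of_adjoin_transcendental hy

/-- The residue field of a place is `ℂ`. -/
theorem Place.exists_val_sub_lt_one (P : Place F) {f : F} (hf : P.val f ≤ 1) :
    ∃ c : ℂ, P.val (f - algebraMap ℂ F c) < 1 := by
  -- Otherwise the valuation is trivial on `ℂ(f)`. Since `F` is integral over `ℂ(f)`, all of `F`
  -- would lie in the valuation ring, and no function would have a pole at `P`.
  by_contra! h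
  have h1 : ∀ c : ℂ, P.val (f - algebraMap ℂ F c) = 1 := fun c =>
    le_antisymm ((P.val.map_sub _ _).trans (max_le hf (P.val_algebraMap_le_one c))) (h c)
  have hpoly : ∀ p : ℂ[X], p ≠ 0 → P.val (aeval f p) = 1 := by
    intro p hp
    rw [(IsAlgClosed.splits p).eq_prod_roots, map_mul, map_mul, aeval_C,
      P.val_algebraMap _ (leadingCoeff_ne_zero.2 hp), one_mul, map_multiset_prod,
      map_multiset_prod]
    refine Multiset.prod_eq_one fun y hy => ?_
    simp only [Multiset.map_map, Multiset.mem_map, Function.comp_apply] at hy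
    obtain ⟨c, -, rfl⟩ := hy
    simpa using h1 c
  have htr : Transcendental ℂ f := by
    rintro ⟨p, hp, h0⟩
    have := hpoly p hp
    simp [h0] at this
  have := finiteDimensional_adjoin htr
  have hle : ∀ y : ℂ⟮f⟯, P.val (y : F) ≤ 1 := by
    rintro ⟨y, hy⟩
    obtain ⟨r, s, rfl⟩ := (mem_adjoin_simple_iff ℂ y).1 hy
    rcases eq_or_ne r 0 with rfl | hr
    · simp
    rcases eq_or_ne s 0 with rfl | hs
    · simp
    simp [hpoly r hr, hpoly s hs]
  obtain ⟨t, ht⟩ := P.exists_val_eq 1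
  have hint : IsIntegral ℂ⟮f⟯ t := Algebra.IsIntegral.isIntegral t
  have hint' : IsIntegral P.val.integer t := by
    obtain ⟨p, hp, hpt⟩ := hint
    let φ : ℂ⟮f⟯ →+* P.val.integer := (algebraMap ℂ⟮f⟯ F).codRestrict _ hle
    refine ⟨p.map φ, hp.map φ, ?_⟩
    rw [eval₂_map]
    exact hpt
  have := (Valuation.integer.integers P.val).mem_of_integral hint'
  rw [Valuation.mem_integer_iff, ht, ← WithZero.exp_zero, WithZero.exp_le_exp] at this
  omega

theorem Place.exists_sub_smul_mem (P : Place F) {f g : F} {n : ℤ} (hf : f ∈ stalk P n)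
    (hg : P.val g = WithZero.exp n) : ∃ c : ℂ, f - c • g ∈ stalk P (n - 1) := by
  have hg0 := P.ne_zero_of_val_eq_exp hg
  obtain ⟨c, hc⟩ := P.exists_val_sub_lt_one (f := f / g) (by
    rw [map_div₀, hg]
    exact div_le_one_of_le₀ hf zero_le)
  refine ⟨c, P.val_le_exp_sub_one ?_⟩
  have : f - c • g = (f / g - algebraMap ℂ F c) * g := by
    rw [Algebra.smul_def]; field_simp
  rw [this, map_mul, hg]
  exact mul_lt_of_lt_one_left (by simp) hc

end FunctionField

end Places

end TameHitchin

end

noncomputable section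

namespace TameHitchin

open IntermediateField Polynomial
open scoped IntermediateField.algebraAdjoinAdjoin
open IsDedekindDomain (HeightOneSpectrum)

/-! ### Affine charts: places as primes of a Dedekind domain. -/

section Chart

variable {F : Type u} [Field F] [Algebra ℂ F]

/-- The integral closure of `ℂ[x]` in the function field: the functions that are regular on the
affine part of the curve where `x` is regular. -/
abbrev chart (x : F) : Subalgebra (Algebra.adjoin ℂ {x}) F :=
  integralClosure (Algebra.adjoin ℂ {x}) F

theorem isDedekindDomain_adjoin (x : F) : IsDedekindDomain (Algebra.adjoin ℂ {x}) := by
  have : IsPrincipalIdealRing (Algebra.adjoin ℂ {x}) := by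
    refine IsPrincipalIdealRing.of_surjective
      ((aeval (⟨x, Algebra.self_mem_adjoin_singleton ℂ x⟩ : Algebra.adjoin ℂ {x}) :
        ℂ[X] →ₐ[ℂ] Algebra.adjoin ℂ {x})) ?_
    rintro ⟨y, hy⟩
    obtain ⟨p, rfl⟩ := Algebra.adjoin_singleton_eq_range_aeval ℂ x ▸ hy
    refine ⟨p, Subtype.ext ?_⟩
    simp
  infer_instance

/-- The function `x`, as an element of its chart. -/
def chartGen (x : F) : chart x :=
  algebraMap (Algebra.adjoin ℂ {x}) _ ⟨x, Algebra.self_mem_adjoin_singleton ℂ x⟩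

@[simp] theorem algebraMap_chartGen (x : F) : algebraMap (chart x) F (chartGen x) = x := rfl

theorem Place.val_le_one_of_mem_chart (P : Place F) {x : F} (hx : P.val x ≤ 1) (a : chart x) :
    P.val (algebraMap (chart x) F a) ≤ 1 := by
  obtain ⟨a, p, hp, hpa⟩ := a
  have hle : ∀ y : Algebra.adjoin ℂ {x}, P.val (y : F) ≤ 1 := by
    rintro ⟨y, hy⟩
    rw [Algebra.adjoin_singleton_eq_range_aeval] at hy
    obtain ⟨q, rfl⟩ := hy
    exact P.val_aeval_le_one hx q
  have hint' : IsIntegral P.val.integer a := by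
    let φ : Algebra.adjoin ℂ {x} →+* P.val.integer := (algebraMap _ F).codRestrict _ hle
    refine ⟨p.map φ, hp.map φ, ?_⟩
    rw [eval₂_map]
    exact hpa
  exact (Valuation.integer.integers P.val).mem_of_integral hint'

/-- A place is the adic valuation of the prime of a Dedekind chart that it lies on. -/
theorem Place.exists_eq_valuation (P : Place F) (A : Type*) [CommRing A] [IsDedekindDomain A]
    [Algebra A F] [IsFractionRing A F] (hA : ∀ a : A, P.val (algebraMap A F a) ≤ 1) :
    ∃ v : HeightOneSpectrum A, v.valuation F = P.val := by
  -- The centre of `P` on the chart. It is nonzero, for otherwise the valuation would be trivial on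
  -- the fraction field.
  let I : Ideal A :=
    { carrier := {a | P.val (algebraMap A F a) < 1}
      add_mem' := fun {a b} ha hb => by
        simp only [Set.mem_ofPred_eq, map_add] at *
        exact (P.val.map_add _ _).trans_lt (max_lt ha hb)
      zero_mem' := by simp
      smul_mem' := fun c a ha => by
        simp only [Set.mem_ofPred_eq, smul_eq_mul, map_mul] at *
        exact mul_lt_one_of_nonneg_of_lt_one_right (hA c) zero_le ha }
  have hI : ∀ a : A, a ∈ I ↔ P.val (algebraMap A F a) < 1 := fun a => Iff.rfl
  have hprime : I.IsPrime := by
    refine ⟨fun h => ?_, fun {a b} hab => ?_⟩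
    · have := (Ideal.eq_top_iff_one I).1 h
      simp [hI] at this
    · by_contra! hcon
      simp only [hI, not_lt] at hcon
      rw [hI, map_mul, map_mul] at hab
      exact absurd hab (not_lt.2 (one_le_mul hcon.1 hcon.2))
  have hbot : I ≠ ⊥ := by
    intro h
    have h1 : ∀ a : A, a ≠ 0 → P.val (algebraMap A F a) = 1 := fun a ha =>
      le_antisymm (hA a) (not_lt.1 fun hlt => ha (by simpa [h] using (hI a).2 hlt))
    obtain ⟨t, ht⟩ := P.exists_val_eq 1
    obtain ⟨a, b, hb, rfl⟩ := IsFractionRing.div_surjective (A := A) t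
    have hb0 := nonZeroDivisors.ne_zero hb
    rcases eq_or_ne a 0 with rfl | ha
    · exact P.ne_zero_of_val_eq_exp ht (by simp)
    · rw [map_div₀, h1 a ha, h1 b hb0, div_one, ← WithZero.exp_zero, WithZero.exp_inj] at ht
      omega
  let v : HeightOneSpectrum A := ⟨I, hprime, hbot⟩
  have hle : ∀ f : F, v.valuation F f ≤ 1 → P.val f ≤ 1 := by
    intro f hf
    obtain ⟨n, d, hnd⟩ := v.exists_primeCompl_mul_eq_of_integer f hf
    have hd : P.val (algebraMap A F d) = 1 :=
      le_antisymm (hA _) (not_lt.1 fun h => d.2 ((hI _).2 h))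
    have := hA n
    rwa [← hnd, map_mul, hd, mul_one] at this
  obtain ⟨π, hπ⟩ := v.intValuation_exists_uniformizer
  rw [← HeightOneSpectrum.valuation_of_algebraMap (K := F)] at hπ
  set p := algebraMap A F π with hp
  have hp0 : p ≠ 0 := (Valuation.ne_zero_iff _).1 (hπ ▸ WithZero.exp_ne_zero)
  -- Dividing `f` by a power of the uniformizer `p` gives a unit for `v`; by `hle`, applied to it
  -- and to its inverse, it is a unit for `P` as well. So `P.val` is determined by `P.val p`.
  have key : ∀ f : F, f ≠ 0 → ∃ n : ℤ, v.valuation F f = WithZero.exp (-n) ∧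
      P.val f = P.val p ^ n := by
    intro f hf
    have hv0 : v.valuation F f ≠ 0 := (Valuation.ne_zero_iff _).2 hf
    refine ⟨-(v.valuation F f).log, by rw [neg_neg, WithZero.exp_log hv0], ?_⟩
    set n := -(v.valuation F f).log with hn
    have hu : v.valuation F (f / p ^ n) = 1 := by
      rw [map_div₀, map_zpow₀, hπ, ← WithZero.exp_zsmul]
      simp [hn, WithZero.exp_log hv0, hv0]
    have h1 : P.val (f / p ^ n) = 1 := by
      refine le_antisymm (hle _ hu.le) ?_
      have := hle (f / p ^ n)⁻¹ (by rw [map_inv₀, hu, inv_one])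
      rw [map_inv₀] at this
      exact (inv_le_one₀ (zero_lt_iff.2 ((Valuation.ne_zero_iff _).2
        (div_ne_zero hf (zpow_ne_zero _ hp0))))).1 this
    rw [map_div₀, map_zpow₀] at h1
    exact (div_eq_one_iff_eq (zpow_ne_zero _ ((Valuation.ne_zero_iff _).2 hp0))).1 h1
  have hpval : P.val p = WithZero.exp (-1) := by
    have hlt : P.val p < 1 := by
      have : π ∈ v.asIdeal := (v.valuation_lt_one_iff_mem (K := F) π).1 (by
        refine (hπ.trans_lt ?_); rw [← WithZero.exp_zero, WithZero.exp_lt_exp]; omega)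
      exact this
    have hpv0 : P.val p ≠ 0 := (Valuation.ne_zero_iff _).2 hp0
    -- `P` is normalized, so the exponent `e` of `P.val p` divides `-1`; as `e < 0`, it is `-1`.
    obtain ⟨t, ht⟩ := P.exists_val_eq (-1)
    have ht0 : t ≠ 0 := P.ne_zero_of_val_eq_exp ht
    obtain ⟨n, -, hn⟩ := key t ht0
    rw [ht] at hn
    set e := (P.val p).log with he
    rw [← WithZero.exp_log hpv0, ← he] at hn hlt ⊢
    rw [← WithZero.exp_zero, WithZero.exp_lt_exp] at hlt
    rw [← WithZero.exp_zsmul, WithZero.exp_inj, smul_eq_mul] at hn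
    rw [WithZero.exp_inj]
    have := Int.isUnit_iff.1 (IsUnit.of_mul_eq_one (-n) (show e * (-n) = 1 by linarith))
    omega
  refine ⟨v, ?_⟩
  ext f
  rcases eq_or_ne f 0 with rfl | hf
  · simp
  obtain ⟨n, h1, h2⟩ := key f hf
  rw [h1, h2, hpval, ← WithZero.exp_zsmul]
  simp

/-- The place of a function field attached to a prime of a Dedekind chart. -/
def Place.ofPrime {A : Type*} [CommRing A] [IsDedekindDomain A] [Algebra A F] [IsFractionRing A F]
    [Algebra ℂ A] [IsScalarTower ℂ A F] (v : HeightOneSpectrum A) : Place F where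
  val := v.valuation F
  val_algebraMap c hc := by
    rw [IsScalarTower.algebraMap_apply ℂ A F, v.valuation_eq_one_iff_notMem]
    intro h
    exact v.isPrime.ne_top (Ideal.eq_top_of_isUnit_mem _ h ((IsUnit.mk0 c hc).map _))
  surjective := v.valuation_surjective F

theorem chartGen_ne_zero {x : F} (hx : Transcendental ℂ x) : chartGen x ≠ 0 := by
  intro h
  rw [← algebraMap_chartGen x, h, map_zero] at hx
  exact hx isAlgebraic_zero

variable [IsFunctionField F]

theorem chart_isDedekind {x : F} (hx : Transcendental ℂ x) :
    IsDedekindDomain (chart x) ∧ IsFractionRing (chart x) F := by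
  have := finiteDimensional_adjoin hx
  have := isDedekindDomain_adjoin x
  exact ⟨integralClosure.isDedekindDomain _ ℂ⟮x⟯ F,
    integralClosure.isFractionRing_of_finite_extension ℂ⟮x⟯ F⟩

/-- The zeros of `x` are primes of its chart dividing the nonzero element `x`. -/
theorem finite_val_lt_one {x : F} (hx : Transcendental ℂ x) :
    {P : Place F | P.val x < 1}.Finite := by
  obtain ⟨_, _⟩ := chart_isDedekind hx
  have hx0 := chartGen_ne_zero hx
  have hfin : {v : HeightOneSpectrum (chart x) | v.asIdeal ∣ Ideal.span {chartGen x}}.Finite :=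
    Ideal.finite_factors (by simpa using hx0)
  have hex : ∀ P : Place F, P.val x ≤ 1 → ∃ v : HeightOneSpectrum (chart x),
    v.valuation F = P.val := fun P hP =>
      P.exists_eq_valuation (chart x) (P.val_le_one_of_mem_chart hP)
  refine (hfin.image fun v => Place.ofPrime v).subset ?_
  intro P hP
  obtain ⟨v, hv⟩ := hex P (le_of_lt hP)
  refine ⟨v, ?_, Place.ext_val hv⟩
  rw [Set.mem_ofPred_eq, ← v.valuation_lt_one_iff_dvd (K := F), hv]
  exact hP

/-- A unit of an integral extension lying in the base ring is a unit there, and `x` is not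
invertible in the polynomial ring `ℂ[x]`; so some maximal ideal of the chart contains `x`. -/
theorem exists_val_lt_one {x : F} (hx : Transcendental ℂ x) : ∃ P : Place F, P.val x < 1 := by
  obtain ⟨_, _⟩ := chart_isDedekind hx
  have hx0 := chartGen_ne_zero hx
  have hunit : ¬ IsUnit (chartGen x) := by
    intro h
    have hint : (algebraMap (Algebra.adjoin ℂ {x}) (chart x)).IsIntegral :=
      integralClosure.AlgebraIsIntegral.isIntegral
    have hinj : Function.Injective (algebraMap (Algebra.adjoin ℂ {x}) (chart x)) :=
      fun a b hab => Subtype.ext (congrArg (fun z : chart x => (z : F)) hab)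
    obtain ⟨⟨y, hy⟩, hxy, -⟩ :=
      isUnit_iff_exists.1 ((hint.isLocalHom hinj).map_nonunit _ h)
    rw [Algebra.adjoin_singleton_eq_range_aeval] at hy
    obtain ⟨p, rfl⟩ := hy
    have hxy' : x * aeval x p = 1 := congrArg Subtype.val hxy
    refine hx ⟨X * p - 1, fun h0 => ?_, by simp [hxy']⟩
    have := congrArg (Polynomial.eval 0) h0
    simp at this
  obtain ⟨M, hM, hle⟩ := Ideal.exists_le_maximal (Ideal.span {chartGen x}) (by
    rwa [Ne, Ideal.span_singleton_eq_top])
  have hmem : chartGen x ∈ M := hle (Ideal.mem_span_singleton_self _)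
  let v : HeightOneSpectrum (chart x) := ⟨M, hM.isPrime, fun h => hx0 (by simpa [h] using hmem)⟩
  exact ⟨Place.ofPrime v, (v.valuation_lt_one_iff_mem (K := F) _).2 hmem⟩

/-- The inverse of the prime ideal of `P` is strictly larger than the chart. An element of it
outside the chart has a pole at `P`, of order one only, and none at the other primes. -/
theorem exists_val_eq_exp_one {x : F} (hx : Transcendental ℂ x) {P : Place F} (hP : P.val x ≤ 1) :
    ∃ f : F, P.val f = WithZero.exp 1 ∧ ∀ Q : Place F, Q ≠ P → Q.val x ≤ 1 → Q.val f ≤ 1 := by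
  obtain ⟨_, _⟩ := chart_isDedekind hx
  have hex : ∀ P : Place F, P.val x ≤ 1 → ∃ v : HeightOneSpectrum (chart x),
    v.valuation F = P.val := fun P hP =>
      P.exists_eq_valuation (chart x) (P.val_le_one_of_mem_chart hP)
  obtain ⟨v, hv⟩ := hex P hP
  obtain ⟨f, hf, hf1⟩ := FractionalIdeal.exists_notMem_one_of_ne_bot (K := F)
    v.ne_bot v.isPrime.ne_top
  rw [FractionalIdeal.mem_one_iff] at hf1
  rw [FractionalIdeal.mem_inv_iff (by simpa using v.ne_bot)] at hf
  have hfa : ∀ a ∈ v.asIdeal, ∃ b : chart x, algebraMap _ F b = f * algebraMap _ F a := by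
    intro a ha
    exact (FractionalIdeal.mem_one_iff _).1 (hf _ (FractionalIdeal.mem_coeIdeal_of_mem _ ha))
  have hother : ∀ w : HeightOneSpectrum (chart x), w ≠ v → w.valuation F f ≤ 1 := by
    intro w hw
    have : ∃ a ∈ v.asIdeal, a ∉ w.asIdeal := by
      by_contra! hcon
      exact hw (HeightOneSpectrum.ext (v.isMaximal.eq_of_le w.isPrime.ne_top hcon).symm)
    obtain ⟨a, ha, haw⟩ := this
    obtain ⟨b, hb⟩ := hfa a ha
    have h1 : w.valuation F (algebraMap _ F b) ≤ 1 := w.valuation_le_one b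
    have h2 : w.valuation F (algebraMap _ F a) = 1 := w.valuation_eq_one_iff_notMem.2 haw
    rwa [hb, map_mul, h2, mul_one] at h1
  refine ⟨f, ?_, fun Q hQ hQx => ?_⟩
  · rw [← hv]
    have hgt : 1 < v.valuation F f := by
      by_contra! hcon
      refine hf1 ?_
      obtain ⟨a, ha⟩ := HeightOneSpectrum.mem_integers_of_valuation_le_one F f fun w => by
        rcases eq_or_ne w v with rfl | hw
        · exact hcon
        · exact hother w hw
      exact ⟨a, ha⟩
    obtain ⟨π, hπ⟩ := v.intValuation_exists_uniformizer
    rw [← HeightOneSpectrum.valuation_of_algebraMap (K := F)] at hπ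
    have hmem : π ∈ v.asIdeal := (v.valuation_lt_one_iff_mem (K := F) π).1 (by
        refine (hπ.trans_lt ?_); rw [← WithZero.exp_zero, WithZero.exp_lt_exp]; omega)
    obtain ⟨b, hb⟩ := hfa π hmem
    have h1 : v.valuation F (algebraMap _ F b) ≤ 1 := v.valuation_le_one b
    have h2 : v.valuation F (algebraMap _ F π) = WithZero.exp (-1) := hπ
    rw [hb, map_mul, h2] at h1
    have hv0 : v.valuation F f ≠ 0 := (zero_lt_one.trans hgt).ne'
    rw [← WithZero.exp_log hv0] at h1 hgt ⊢
    rw [← WithZero.exp_add, ← WithZero.exp_zero, WithZero.exp_le_exp] at h1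
    rw [← WithZero.exp_zero, WithZero.exp_lt_exp] at hgt
    rw [WithZero.exp_inj]
    omega
  · obtain ⟨w, hw⟩ := hex Q hQx
    rw [← hw]
    refine hother w fun h => hQ (Place.ext_val ?_)
    rw [← hw, h, hv]

end Chart

end TameHitchin

end

noncomputable section

namespace TameHitchin

open IntermediateField Polynomial

/-! ### Divisors of functions and global sections. -/

section PrincipalDivisors

variable {F : Type u} [Field F] [Algebra ℂ F]

theorem mem_H0 {D : Divisor F} {f : F} : f ∈ H0 D ↔ ∀ P : Place F, f ∈ stalk P (D P) :=
  Submodule.mem_iInf _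

theorem H0_mono {D E : Divisor F} (h : D ≤ E) : H0 D ≤ H0 E := fun _ hf =>
  mem_H0.2 fun P => stalk_mono P (h P) (mem_H0.1 hf P)

theorem mem_boundedRepartitions {D : Divisor F} {α : Place F → F} :
    α ∈ boundedRepartitions D ↔ ∀ P : Place F, α P ∈ stalk P (D P) := by
  simp [boundedRepartitions]

theorem const_mem_principalRepartitions (f : F) :
    (fun _ : Place F => f) ∈ principalRepartitions F :=
  ⟨f, rfl⟩

theorem mul_mem_stalk {P : Place F} {f g : F} {m n : ℤ} (hf : f ∈ stalk P m)
    (hg : g ∈ stalk P n) : f * g ∈ stalk P (m + n) := by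
  rw [mem_stalk, map_mul, WithZero.exp_add]
  exact mul_le_mul' hf hg

theorem eq_algebraMap_or_transcendental (f : F) :
    (∃ c : ℂ, algebraMap ℂ F c = f) ∨ Transcendental ℂ f := by
  by_cases h : ∃ c : ℂ, algebraMap ℂ F c = f
  · exact Or.inl h
  · exact Or.inr (transcendental_of_notMem_range (not_exists.1 h))

theorem transcendental_inv {f : F} (hf : Transcendental ℂ f) : Transcendental ℂ f⁻¹ :=
  fun h => hf (by simpa using h.inv)

variable [IsFunctionField F]

theorem finite_val_ne_one {f : F} (hf : f ≠ 0) : {P : Place F | P.val f ≠ 1}.Finite := by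
  rcases eq_algebraMap_or_transcendental f with ⟨c, rfl⟩ | h
  · convert Set.finite_empty
    rw [Set.eq_empty_iff_forall_notMem]
    intro P hP
    exact hP (P.val_algebraMap c fun hc => hf (by simp [hc]))
  · refine ((finite_val_lt_one h).union (finite_val_lt_one (transcendental_inv h))).subset ?_
    intro P hP
    rcases lt_or_gt_of_ne hP with hlt | hgt
    · exact Or.inl hlt
    · refine Or.inr ?_
      rw [Set.mem_ofPred_eq, map_inv₀]
      exact inv_lt_one_of_one_lt₀ hgt

/-- The divisor of a rational function (with the value `0` at the function `0`). -/
def divisorOf (f : F) : Divisor F :=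
  Finsupp.ofSupportFinite (fun P : Place F => -(P.val f).log) (by
    rcases eq_or_ne f 0 with rfl | hf
    · simp [Function.support]
    · refine (finite_val_ne_one hf).subset fun P hP h => hP ?_
      simp [h])

theorem val_eq_exp_divisorOf {f : F} (hf : f ≠ 0) (P : Place F) :
    P.val f = WithZero.exp (-(divisorOf f P)) := by
  change P.val f = WithZero.exp (-(-(P.val f).log))
  rw [neg_neg, WithZero.exp_log ((Valuation.ne_zero_iff _).2 hf)]

theorem mem_stalk_iff_divisorOf {f : F} (hf : f ≠ 0) {P : Place F} {n : ℤ} :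
    f ∈ stalk P n ↔ -(divisorOf f P) ≤ n := by
  rw [mem_stalk, val_eq_exp_divisorOf hf, WithZero.exp_le_exp]

theorem const_mem_repartitions (f : F) : (fun _ : Place F => f) ∈ repartitions F := by
  rcases eq_or_ne f 0 with rfl | hf
  · exact (repartitions F).zero_mem
  · refine (finite_val_ne_one hf).subset fun P hP h => hP ?_
    exact mem_stalk_zero.2 h.le

/-- A nonconstant function has a pole, namely a zero of its inverse. -/
theorem mem_H0_zero {f : F} : f ∈ H0 (0 : Divisor F) ↔ ∃ c : ℂ, algebraMap ℂ F c = f := by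
  constructor
  · intro hf
    refine (eq_algebraMap_or_transcendental f).resolve_right fun h => ?_
    obtain ⟨P, hP⟩ := exists_val_lt_one (transcendental_inv h)
    have h1 : P.val f ≤ 1 := mem_stalk_zero.1 (mem_H0.1 hf P)
    have hf0 : f ≠ 0 := by rintro rfl; exact h isAlgebraic_zero
    rw [map_inv₀] at hP
    exact absurd hP (not_lt.2 ((one_le_inv₀ (zero_lt_iff.2 ((Valuation.ne_zero_iff _).2 hf0))).2 h1))
  · rintro ⟨c, rfl⟩
    exact mem_H0.2 fun P => mem_stalk_zero.2 (P.val_algebraMap_le_one c)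

theorem H0_zero_eq_span : H0 (0 : Divisor F) = Submodule.span ℂ {1} := by
  ext f
  rw [mem_H0_zero, Submodule.mem_span_singleton]
  simp [Algebra.algebraMap_eq_smul_one]

theorem finrank_H0_zero : Module.finrank ℂ (H0 (0 : Divisor F)) = 1 := by
  rw [H0_zero_eq_span, finrank_span_singleton one_ne_zero]

theorem nonempty_place : Nonempty (Place F) := by
  obtain ⟨x, hx, -⟩ := IsFunctionField.exists_transcendental (F := F)
  exact ⟨(exists_val_lt_one hx).choose⟩

theorem H0_sub_divisorOf (D : Divisor F) {f : F} (hf : f ≠ 0) :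
    H0 (D - divisorOf f) = (H0 D).map (LinearMap.mulLeft ℂ f) := by
  ext s
  rw [Submodule.mem_map]
  constructor
  · intro hs
    refine ⟨f⁻¹ * s, mem_H0.2 fun P => ?_, by simp [hf]⟩
    have hinv : f⁻¹ ∈ stalk P (divisorOf f P) := by
      rw [mem_stalk, map_inv₀, val_eq_exp_divisorOf hf, ← WithZero.exp_neg, neg_neg]
    have := mul_mem_stalk hinv (mem_H0.1 hs P)
    simpa using this
  · rintro ⟨t, ht, rfl⟩
    refine mem_H0.2 fun P => ?_
    have := mul_mem_stalk ((mem_stalk_iff_divisorOf hf).2 le_rfl) (mem_H0.1 ht P)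
    rw [LinearMap.mulLeft_apply]
    convert this using 1
    rw [Finsupp.sub_apply, sub_eq_neg_add]

theorem finrank_H0_sub_divisorOf (D : Divisor F) {f : F} (hf : f ≠ 0) :
    Module.finrank ℂ (H0 (D - divisorOf f)) = Module.finrank ℂ (H0 D) := by
  rw [H0_sub_divisorOf D hf]
  refine (LinearEquiv.finrank_eq (Submodule.equivMapOfInjective _ ?_ _)).symm
  exact mul_right_injective₀ hf

end PrincipalDivisors

/-! ### Strong approximation, and a divisor with vanishing `H¹`. -/

section Approximation

variable {F : Type u} [Field F] [Algebra ℂ F] [IsFunctionField F]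

/-- The leading polar term is removed by a multiple of a power of a function with a simple pole at
`P`, by induction on the pole order. -/
theorem exists_principal_part {x : F} (hx : Transcendental ℂ x) {P : Place F} (hP : P.val x ≤ 1)
    (n : ℕ) (g : F) (hg : g ∈ stalk P n) :
    ∃ f : F, g - f ∈ stalk P 0 ∧ ∀ Q : Place F, Q ≠ P → Q.val x ≤ 1 → f ∈ stalk Q 0 := by
  induction n generalizing g with
  | zero => exact ⟨0, by simpa using hg, fun Q _ _ => (stalk Q 0).zero_mem⟩
  | succ n ih =>
    obtain ⟨e, he, heQ⟩ := exists_val_eq_exp_one hx hP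
    have he' : P.val (e ^ (n + 1)) = WithZero.exp ((n + 1 : ℕ) : ℤ) := by
      rw [map_pow, he, ← WithZero.exp_nsmul]
      simp
    obtain ⟨c, hc⟩ := P.exists_sub_smul_mem hg he'
    obtain ⟨f, hf, hfQ⟩ := ih (g - c • e ^ (n + 1)) (by simpa using hc)
    refine ⟨f + c • e ^ (n + 1), by rwa [← sub_sub, sub_right_comm], fun Q hQ hQx => ?_⟩
    refine (stalk Q 0).add_mem (hfQ Q hQ hQx) ((stalk Q 0).smul_mem _ (mem_stalk_zero.2 ?_))
    rw [map_pow]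
    exact pow_le_one₀ zero_le (heQ Q hQ hQx)

theorem exists_mem_stalk_natCast (P : Place F) (g : F) : ∃ n : ℕ, g ∈ stalk P n := by
  rcases eq_or_ne g 0 with rfl | hg
  · exact ⟨0, (stalk P _).zero_mem⟩
  · exact ⟨(-(divisorOf g P)).toNat, (mem_stalk_iff_divisorOf hg).2 (Int.self_le_toNat _)⟩

/-- Strong approximation away from the poles of `x`. -/
theorem exists_approximation {x : F} (hx : Transcendental ℂ x) {α : Place F → F}
    (hα : α ∈ repartitions F) : ∃ f : F, ∀ P : Place F, P.val x ≤ 1 → α P - f ∈ stalk P 0 := by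
  classical
  have hS : {P : Place F | ¬ α P ∈ stalk P 0}.Finite := hα
  have hpp : ∀ P : Place F, ∃ f : F, P.val x ≤ 1 →
      (α P - f ∈ stalk P 0 ∧ ∀ Q : Place F, Q ≠ P → Q.val x ≤ 1 → f ∈ stalk Q 0) := by
    intro P
    by_cases hP : P.val x ≤ 1
    · obtain ⟨n, hn⟩ := exists_mem_stalk_natCast P (α P)
      obtain ⟨f, hf⟩ := exists_principal_part hx hP n _ hn
      exact ⟨f, fun _ => hf⟩
    · exact ⟨0, fun h => absurd h hP⟩
  choose f hf using hpp
  let T : Finset (Place F) := hS.toFinset.filter fun P => P.val x ≤ 1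
  have hT : ∀ P, P ∈ T ↔ ¬ α P ∈ stalk P 0 ∧ P.val x ≤ 1 := fun P => by simp [T]
  refine ⟨∑ P ∈ T, f P, fun P hP => ?_⟩
  by_cases hPT : P ∈ T
  · rw [← Finset.add_sum_erase T f hPT, ← sub_sub]
    refine (stalk P 0).sub_mem (hf P hP).1 ((stalk P 0).sum_mem fun Q hQ => ?_)
    exact (hf Q ((hT Q).1 (Finset.mem_of_mem_erase hQ)).2).2 P (Finset.ne_of_mem_erase hQ).symm hP
  · refine (stalk P 0).sub_mem ?_ ((stalk P 0).sum_mem fun Q hQ => ?_)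
    · by_contra h
      exact hPT ((hT P).2 ⟨h, hP⟩)
    · exact (hf Q ((hT Q).1 hQ).2).2 P (fun h => hPT (h ▸ hQ)) hP

omit [IsFunctionField F] in
-- After Euclidean division the remaining fraction has a numerator of degree at most that of the
-- denominator, so it is regular at the poles of `x`. One polynomial serves all these poles.
theorem exists_polynomial_part {x c : F} (hc : c ∈ ℂ⟮x⟯) :
    ∃ q : ℂ[X], ∀ P : Place F, 1 < P.val x → c - aeval x q ∈ stalk P 0 := by
  obtain ⟨r, s, rfl⟩ := (mem_adjoin_simple_iff ℂ c).1 hc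
  rcases eq_or_ne s 0 with rfl | hs
  · exact ⟨0, fun P _ => by simp⟩
  refine ⟨r / s, fun P hP => ?_⟩
  have hs0 : aeval x s ≠ 0 := by
    intro h
    have := P.val_aeval_of_one_lt hP hs
    rw [h, map_zero, eq_comm] at this
    exact (pow_ne_zero _ (zero_lt_one.trans hP).ne') this
  have hdiv : aeval x r / aeval x s - aeval x (r / s) = aeval x (r % s) / aeval x s := by
    have h := congrArg (aeval x) (EuclideanDomain.div_add_mod r s)
    rw [map_add, map_mul] at h
    field_simp
    rw [← h]
    ring
  rw [hdiv]
  rcases eq_or_ne (r % s) 0 with h0 | h0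
  · simp [h0]
  · rw [mem_stalk_zero, map_div₀, P.val_aeval_of_one_lt hP hs, P.val_aeval_of_one_lt hP h0]
    refine div_le_one_of_le₀ (pow_le_pow_right₀ hP.le (natDegree_le_natDegree ?_)) zero_le
    exact (EuclideanDomain.mod_lt r hs).le

theorem exists_divisor_ge (f : F) : ∃ D : Divisor F, 0 ≤ D ∧ f ∈ H0 D := by
  rcases eq_or_ne f 0 with rfl | hf
  · exact ⟨0, le_rfl, (H0 _).zero_mem⟩
  · refine ⟨(divisorOf f).mapRange (fun n => max (-n) 0) (by simp), fun P => ?_,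
      mem_H0.2 fun P => ?_⟩
    · simp
    · rw [mem_stalk_iff_divisorOf hf]
      simp

/-- There is a divisor `D` with `H¹(𝒪(D)) = 0`. -/
theorem exists_repartitions_le : ∃ D : Divisor F,
    repartitions F ≤ boundedRepartitions D ⊔ principalRepartitions F := by
  obtain ⟨x, hx, hfin⟩ := IsFunctionField.exists_transcendental (F := F)
  let u := Module.finBasis ℂ⟮x⟯ F
  choose E hE0 hE using fun i => exists_divisor_ge (u i)
  let D : Divisor F := ∑ i, E i
  have hED : ∀ i, E i ≤ D := fun i => Finset.single_le_sum (fun j _ => hE0 j) (Finset.mem_univ i)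
  have hD0 : 0 ≤ D := Finset.sum_nonneg fun j _ => hE0 j
  have hu : ∀ i P, u i ∈ stalk P (D P) := fun i P => stalk_mono P (hED i P) (mem_H0.1 (hE i) P)
  refine ⟨D, fun α hα => ?_⟩
  -- `f` approximates `α` where `x` is regular, `h` where `x⁻¹` is. The correction `a` collects the
  -- polynomial parts of the coordinates of `h - f` in a basis over `ℂ(x)`: it keeps `f + a` good on
  -- the first chart and brings it close to `h` at the poles of `x`. The divisor `D` only has to
  -- bound the basis.
  obtain ⟨f, hf⟩ := exists_approximation hx hα
  obtain ⟨h, hh⟩ := exists_approximation (transcendental_inv hx) hα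
  choose q hq using fun i => exists_polynomial_part (u.repr (h - f) i).2
  let a : F := ∑ i, aeval x (q i) * u i
  have hb : h - f - a = ∑ i, ((u.repr (h - f) i : F) - aeval x (q i)) * u i := by
    conv_lhs => rw [← u.sum_repr (h - f)]
    simp only [a, ← Finset.sum_sub_distrib, sub_mul]
    rfl
  rw [Submodule.mem_sup]
  refine ⟨fun P => α P - (f + a), mem_boundedRepartitions.2 fun P => ?_, fun _ => f + a,
    const_mem_principalRepartitions _, by ext P; simp⟩
  rcases le_or_gt (P.val x) 1 with hP | hP
  · have ha : a ∈ stalk P (D P) := (stalk P (D P)).sum_mem fun i _ => by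
      simpa using mul_mem_stalk (mem_stalk_zero.2 (P.val_aeval_le_one hP (q i))) (hu i P)
    have := (stalk P (D P)).sub_mem (stalk_mono P (hD0 P) (hf P hP)) ha
    rwa [sub_sub] at this
  · have hb' : h - f - a ∈ stalk P (D P) := by
      rw [hb]
      refine (stalk P (D P)).sum_mem fun i _ => ?_
      simpa using mul_mem_stalk (hq i P hP) (hu i P)
    have h1 := hh P (by rw [map_inv₀]; exact (inv_lt_one_of_one_lt₀ hP).le)
    have := (stalk P (D P)).add_mem (stalk_mono P (hD0 P) h1) hb'
    convert this using 1
    ring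

end Approximation

end TameHitchin

end

noncomputable section

namespace TameHitchin

/-! ### Quotients by one more vector. -/

section LinearAlgebra

variable {K M : Type*} [Field K] [AddCommGroup M] [Module K M]

theorem finite_quotient_sup_span {N : Submodule K M} {v : M} :
    Module.Finite K (M ⧸ (N ⊔ Submodule.span K {v})) ↔ Module.Finite K (M ⧸ N) := by
  let e := Submodule.quotientQuotientEquivQuotientSup N (Submodule.span K {v})
  constructor
  · intro h
    have := Module.Finite.equiv e.symm
    exact Module.Finite.of_submodule_quotient ((Submodule.span K {v}).map N.mkQ)
  · intro h
    exact Module.Finite.equiv e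

theorem finrank_quotient_sup_span {N : Submodule K M} {v : M} (hv : v ∉ N)
    [Module.Finite K (M ⧸ N)] :
    Module.finrank K (M ⧸ N) = Module.finrank K (M ⧸ (N ⊔ Submodule.span K {v})) + 1 := by
  let e := Submodule.quotientQuotientEquivQuotientSup N (Submodule.span K {v})
  rw [← e.finrank_eq, ← Submodule.finrank_quotient_add_finrank ((Submodule.span K {v}).map N.mkQ)]
  congr 1
  rw [Submodule.map_span, Set.image_singleton, finrank_span_singleton]
  simpa using hv

end LinearAlgebra

/-! ### Finiteness of cohomology and Riemann–Roch. -/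

section RiemannRoch

variable {F : Type u} [Field F] [Algebra ℂ F]

/-- The repartitions whose classes vanish in `H¹(𝒪(D))`. -/
abbrev trivialRepartitions (D : Divisor F) : Submodule ℂ (repartitions F) :=
  (boundedRepartitions D ⊔ principalRepartitions F).comap (repartitions F).subtype

theorem mem_trivialRepartitions {D : Divisor F} {α : repartitions F} :
    α ∈ trivialRepartitions D ↔
      ∃ f : F, ∀ P : Place F, (α : Place F → F) P - f ∈ stalk P (D P) := by
  rw [trivialRepartitions, Submodule.mem_comap, Submodule.mem_sup]
  constructor
  · rintro ⟨β, hβ, γ, ⟨f, rfl⟩, h⟩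
    refine ⟨f, fun P => ?_⟩
    have := mem_boundedRepartitions.1 hβ P
    change _ = (α : Place F → F) at h
    rw [← h]
    simpa using this
  · rintro ⟨f, hf⟩
    exact ⟨fun P => (α : Place F → F) P - f, mem_boundedRepartitions.2 hf, fun _ => f, ⟨f, rfl⟩,
      by ext P; simp⟩

theorem trivialRepartitions_mono {D E : Divisor F} (h : D ≤ E) :
    trivialRepartitions D ≤ trivialRepartitions E := fun _ hα => by
  rw [mem_trivialRepartitions] at hα ⊢
  exact hα.imp fun f hf P => stalk_mono P (h P) (hf P)

theorem H1_congr {D E : Divisor F} (h : trivialRepartitions D = trivialRepartitions E) :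
    Nonempty (H1 D ≃ₗ[ℂ] H1 E) :=
  ⟨Submodule.quotEquivOfEq _ _ h⟩

theorem subsingleton_H1_iff {D : Divisor F} :
    Subsingleton (H1 D) ↔ trivialRepartitions D = ⊤ :=
  Submodule.Quotient.subsingleton_iff

theorem subsingleton_H1_mono {D E : Divisor F} (h : D ≤ E) (hD : Subsingleton (H1 D)) :
    Subsingleton (H1 E) := by
  rw [subsingleton_H1_iff] at hD ⊢
  exact top_le_iff.1 (hD ▸ trivialRepartitions_mono h)

open Classical in
/-- The repartition that is `g` at `P` and zero elsewhere. -/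
def singleRepartition (P : Place F) (g : F) : repartitions F :=
  ⟨Pi.single P g, (Set.finite_singleton P).subset fun Q hQ => by
    by_contra h
    exact hQ (by simp [Pi.single_eq_of_ne (show Q ≠ P from h)])⟩

@[simp] theorem singleRepartition_same (P : Place F) (g : F) :
    (singleRepartition P g : Place F → F) P = g := by
  classical
  exact Pi.single_eq_same (M := fun _ => F) P g

theorem singleRepartition_of_ne {P Q : Place F} (h : Q ≠ P) (g : F) :
    (singleRepartition P g : Place F → F) Q = 0 := by
  classical
  exact Pi.single_eq_of_ne (M := fun _ => F) h g

theorem add_divisor_same (D : Divisor F) (P : Place F) : (D + P.divisor) P = D P + 1 := by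
  simp [Place.divisor]

theorem add_divisor_of_ne (D : Divisor F) {P Q : Place F} (h : Q ≠ P) :
    (D + P.divisor) Q = D Q := by
  simp [Place.divisor, h.symm]

theorem le_add_divisor (D : Divisor F) (P : Place F) : D ≤ D + P.divisor := by
  refine le_add_of_nonneg_right fun Q => ?_
  rw [Place.divisor]
  exact Finsupp.single_nonneg.2 zero_le_one Q

theorem mem_H0_of_mem_stalk {D : Divisor F} {P : Place F} {s : F} (hs : s ∈ H0 (D + P.divisor))
    (hP : s ∈ stalk P (D P)) : s ∈ H0 D := mem_H0.2 fun Q => by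
  rcases eq_or_ne Q P with rfl | h
  · exact hP
  · simpa [add_divisor_of_ne D h] using mem_H0.1 hs Q

variable [IsFunctionField F]

/-- Allowing one more pole at `P` either adds one section or kills one class in `H¹`. -/
theorem H0_or_H1_add_divisor (D : Divisor F) (P : Place F) :
    ((∃ s : F, s ∉ H0 D ∧ H0 (D + P.divisor) = H0 D ⊔ Submodule.span ℂ {s}) ∧
      trivialRepartitions (D + P.divisor) = trivialRepartitions D) ∨
    (H0 (D + P.divisor) = H0 D ∧ ∃ δ : repartitions F, δ ∉ trivialRepartitions D ∧
      trivialRepartitions (D + P.divisor) = trivialRepartitions D ⊔ Submodule.span ℂ {δ}) := by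
  obtain ⟨g, hg⟩ := P.exists_val_eq (D P + 1)
  have hgP : g ∉ stalk P (D P) := by
    rw [mem_stalk, hg, WithZero.exp_le_exp]
    omega
  -- Allowing one more pole at `P` enlarges the stalk by one dimension, spanned by `g`. Its class in
  -- `H¹` vanishes exactly when some new global section has a pole of the full order at `P`; this is
  -- the dichotomy.
  have hT : trivialRepartitions (D + P.divisor) =
      trivialRepartitions D ⊔ Submodule.span ℂ {singleRepartition P g} := by
    apply le_antisymm
    · intro α hα
      obtain ⟨f, hf⟩ := mem_trivialRepartitions.1 hα
      have hP := hf P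
      rw [add_divisor_same] at hP
      obtain ⟨c, hc⟩ := P.exists_sub_smul_mem hP hg
      rw [Submodule.mem_sup]
      refine ⟨α - c • singleRepartition P g, mem_trivialRepartitions.2 ⟨f, fun Q => ?_⟩, _,
        Submodule.smul_mem _ c (Submodule.mem_span_singleton_self _), by simp⟩
      rcases eq_or_ne Q P with rfl | hQ
      · simpa [sub_right_comm] using hc
      · have := hf Q
        rw [add_divisor_of_ne D hQ] at this
        simpa [singleRepartition_of_ne hQ] using this
    · refine sup_le (trivialRepartitions_mono (le_add_divisor D P)) ?_
      rw [Submodule.span_singleton_le_iff_mem]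
      refine mem_trivialRepartitions.2 ⟨0, fun Q => ?_⟩
      rcases eq_or_ne Q P with rfl | hQ
      · rw [singleRepartition_same, sub_zero, add_divisor_same, mem_stalk, hg]
      · simp [singleRepartition_of_ne hQ]
  by_cases hs : H0 (D + P.divisor) ≤ H0 D
  · refine Or.inr ⟨le_antisymm hs (H0_mono (le_add_divisor D P)), _, fun hδ => ?_, hT⟩
    obtain ⟨f, hf⟩ := mem_trivialRepartitions.1 hδ
    have hfP := hf P
    rw [singleRepartition_same] at hfP
    have hfQ : ∀ Q, Q ≠ P → f ∈ stalk Q (D Q) := fun Q hQ => by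
      have := hf Q
      rw [singleRepartition_of_ne hQ, zero_sub] at this
      exact (stalk Q _).neg_mem_iff.1 this
    have hgm : g ∈ stalk P (D P + 1) := hg.le
    have hmem : f ∈ H0 (D + P.divisor) := mem_H0.2 fun Q => by
      rcases eq_or_ne Q P with rfl | hQ
      · rw [add_divisor_same]
        have := (stalk Q (D Q + 1)).sub_mem hgm (stalk_mono Q (by omega) hfP)
        simpa using this
      · rw [add_divisor_of_ne D hQ]
        exact hfQ Q hQ
    refine hgP ?_
    have := (stalk P (D P)).add_mem hfP (mem_H0.1 (hs hmem) P)
    simpa using this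
  · rw [SetLike.not_le_iff_exists] at hs
    obtain ⟨s, hs, hsD⟩ := hs
    have hsm := mem_H0.1 hs P
    rw [add_divisor_same] at hsm
    have hval : P.val s = WithZero.exp (D P + 1) := by
      refine le_antisymm hsm (not_lt.1 fun hlt => hsD (mem_H0_of_mem_stalk hs ?_))
      have := P.val_le_exp_sub_one hlt
      rwa [add_sub_cancel_right] at this
    refine Or.inl ⟨⟨s, hsD, le_antisymm (fun t ht => ?_) ?_⟩, ?_⟩
    · have htP := mem_H0.1 ht P
      rw [add_divisor_same] at htP
      obtain ⟨c, hc⟩ := P.exists_sub_smul_mem htP hval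
      rw [Submodule.mem_sup]
      exact ⟨t - c • s, mem_H0_of_mem_stalk (Submodule.sub_mem _ ht (Submodule.smul_mem _ c hs))
        (by simpa using hc), _, Submodule.smul_mem _ c (Submodule.mem_span_singleton_self _),
        by simp⟩
    · exact sup_le (H0_mono (le_add_divisor D P)) ((Submodule.span_singleton_le_iff_mem _ _).2 hs)
    · rw [hT, sup_eq_left, Submodule.span_singleton_le_iff_mem]
      obtain ⟨c, hc⟩ := P.exists_sub_smul_mem (f := g) hg.le hval
      refine mem_trivialRepartitions.2 ⟨c • s, fun Q => ?_⟩
      rcases eq_or_ne Q P with rfl | hQ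
      · simpa using hc
      · have := mem_H0.1 hs Q
        rw [add_divisor_of_ne D hQ] at this
        rw [singleRepartition_of_ne hQ, zero_sub]
        exact (stalk Q _).neg_mem ((stalk Q _).smul_mem c this)

omit [IsFunctionField F] in
-- Any two divisors are joined by adding and removing points, so a property invariant under adding a
-- point needs only one base case. For `H⁰` and Riemann–Roch this is `0`; for finiteness of `H¹` it
-- is a divisor with vanishing `H¹`.
theorem divisor_induction {p : Divisor F → Prop} {D₀ : Divisor F} (h₀ : p D₀)
    (h : ∀ (D : Divisor F) (P : Place F), p (D + P.divisor) ↔ p D) (D : Divisor F) : p D := by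
  have key : ∀ E D : Divisor F, p (D + E) ↔ p D := by
    intro E
    induction E using Finsupp.induction_linear with
    | zero => intro D; rw [add_zero]
    | add E E' hE hE' => intro D; rw [← add_assoc, hE', hE]
    | single P n =>
      induction n using Int.induction_on with
      | zero => intro D; rw [Finsupp.single_zero, add_zero]
      | succ n ih =>
        intro D
        rw [Finsupp.single_add, ← add_assoc]
        exact (h _ P).trans (ih D)
      | pred n ih =>
        intro D
        have hD : D + Finsupp.single P (-(n : ℤ) - 1) + P.divisor =
            D + Finsupp.single P (-(n : ℤ)) := by
          rw [add_assoc, Place.divisor, ← Finsupp.single_add, sub_add_cancel]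
        rw [← ih D, ← hD, h]
  have := (key (D - D₀) D₀).2 h₀
  rwa [add_sub_cancel] at this

theorem finite_H0_and_H1 (D : Divisor F) : Module.Finite ℂ (H0 D) ∧ Module.Finite ℂ (H1 D) := by
  have hH0 : ∀ D : Divisor F, Module.Finite ℂ (H0 D) := by
    refine divisor_induction (D₀ := 0) ?_ fun D P => ⟨fun hfin => ?_, fun hfin => ?_⟩
    · rw [H0_zero_eq_span]
      infer_instance
    · exact Submodule.finiteDimensional_of_le (H0_mono (le_add_divisor D P))
    · rcases H0_or_H1_add_divisor D P with ⟨⟨s, -, h⟩, -⟩ | ⟨h, -⟩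
      · rw [h]
        infer_instance
      · rwa [h]
  have hH1 : ∀ D : Divisor F, Module.Finite ℂ (H1 D) := by
    obtain ⟨D₀, h₀⟩ := exists_repartitions_le (F := F)
    refine divisor_induction (D₀ := D₀) ?_ fun D P => ?_
    · have : Subsingleton (H1 D₀) := subsingleton_H1_iff.2 (top_le_iff.1 fun α _ => h₀ α.2)
      infer_instance
    · rcases H0_or_H1_add_divisor D P with ⟨-, h⟩ | ⟨-, δ, -, h⟩
      · obtain ⟨e⟩ := H1_congr h
        exact ⟨fun _ => Module.Finite.equiv e, fun _ => Module.Finite.equiv e.symm⟩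
      · refine Iff.trans ?_ (finite_quotient_sup_span (v := δ))
        rw [← h]
  exact ⟨hH0 D, hH1 D⟩

instance finite_H0 (D : Divisor F) : Module.Finite ℂ (H0 D) := (finite_H0_and_H1 D).1

instance finite_H1 (D : Divisor F) : Module.Finite ℂ (H1 D) := (finite_H0_and_H1 D).2

/-- The Riemann–Roch theorem, without duality. -/
theorem riemannRoch (D : Divisor F) :
    (Module.finrank ℂ (H0 D) : ℤ) - Module.finrank ℂ (H1 D) = D.degree + 1 - genus F := by
  revert D
  refine divisor_induction (D₀ := 0) ?_ fun D P => ?_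
  · rw [finrank_H0_zero, genus]
    simp
  · have hdeg : (D + P.divisor).degree = D.degree + 1 := by
      rw [map_add, Place.divisor, Finsupp.degree_single]
    rcases H0_or_H1_add_divisor D P with ⟨⟨s, hs, h⟩, h'⟩ | ⟨h, δ, hδ, h'⟩
    · have h0 : Module.finrank ℂ (H0 (D + P.divisor)) = Module.finrank ℂ (H0 D) + 1 := by
        have := Submodule.finrank_sup_add_finrank_inf_eq (H0 D) (Submodule.span ℂ {s})
        rwa [(Submodule.disjoint_span_singleton_of_notMem hs).eq_bot, finrank_bot, add_zero,
          finrank_span_singleton (by rintro rfl; exact hs (H0 D).zero_mem), ← h] at this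
      have h1 : Module.finrank ℂ (H1 (D + P.divisor)) = Module.finrank ℂ (H1 D) := by
        exact (H1_congr h').some.finrank_eq
      rw [h0, h1, hdeg]
      push_cast
      constructor <;> intro <;> linarith
    · have h1 : Module.finrank ℂ (H1 D) = Module.finrank ℂ (H1 (D + P.divisor)) + 1 := by
        rw [finrank_quotient_sup_span hδ, ← h']
      rw [h, h1, hdeg]
      push_cast
      constructor <;> intro <;> linarith

/-- Principal divisors have degree zero. -/
theorem degree_divisorOf {f : F} (hf : f ≠ 0) : (divisorOf f).degree = 0 := by
  obtain ⟨D₀, h₀⟩ := exists_repartitions_le (F := F)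
  have hD₀ : Subsingleton (H1 D₀) := subsingleton_H1_iff.2 (top_le_iff.1 fun α _ => h₀ α.2)
  -- `E` dominates both `0` and the divisor of `f`, so `H¹` vanishes for `D₀ + E` and for `D₀ + E -
  -- divisorOf f`. Multiplication by `f` identifies their sections, and Riemann–Roch then equates
  -- the degrees.
  let E : Divisor F := divisorOf f ⊔ 0
  have h1 := riemannRoch (D₀ + E)
  have h2 := riemannRoch (D₀ + E - divisorOf f)
  have s1 : Subsingleton (H1 (D₀ + E)) :=
    subsingleton_H1_mono (le_add_of_nonneg_right le_sup_right) hD₀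
  have s2 : Subsingleton (H1 (D₀ + E - divisorOf f)) := by
    refine subsingleton_H1_mono ?_ hD₀
    rw [add_sub_assoc]
    exact le_add_of_nonneg_right (sub_nonneg.2 le_sup_left)
  rw [Module.finrank_zero_of_subsingleton (M := H1 _)] at h1
  rw [finrank_H0_sub_divisorOf _ hf, Module.finrank_zero_of_subsingleton (M := H1 _), map_sub] at h2
  linarith

theorem degree_nonneg_of_mem_H0 {D : Divisor F} {f : F} (hf : f ≠ 0) (h : f ∈ H0 D) :
    0 ≤ D.degree := by
  have hle : 0 ≤ D + divisorOf f := fun P => by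
    have := (mem_stalk_iff_divisorOf hf).1 (mem_H0.1 h P)
    simp only [Finsupp.coe_zero, Pi.zero_apply, Finsupp.add_apply]
    linarith
  have hdeg : 0 ≤ (D + divisorOf f).degree := by
    rw [Finsupp.degree_apply]
    exact Finset.sum_nonneg fun P _ => hle P
  rwa [map_add, degree_divisorOf hf, add_zero] at hdeg

theorem H0_eq_bot {D : Divisor F} (h : D.degree < 0) : H0 D = ⊥ := by
  rw [eq_bot_iff]
  intro f hf
  by_contra h0
  exact absurd (degree_nonneg_of_mem_H0 h0 hf) (not_le.2 h)

end RiemannRoch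

end TameHitchin

end

noncomputable section

namespace TameHitchin

/-! ### Weil differentials and Serre duality. -/

section Duality

variable {F : Type u} [Field F] [Algebra ℂ F] [IsFunctionField F]

theorem mul_mem_repartitions (f : F) {α : Place F → F} (hα : α ∈ repartitions F) :
    (fun P => f * α P) ∈ repartitions F := by
  refine (hα.union (const_mem_repartitions f)).subset fun P hP => ?_
  by_contra hcon
  simp only [Set.mem_union, Set.mem_ofPred_eq, not_or, not_not] at hcon
  exact hP (by simpa using mul_mem_stalk hcon.2 hcon.1)

/-- Multiplication of repartitions by a rational function. -/
def mulRepartition : F →ₗ[ℂ] repartitions F →ₗ[ℂ] repartitions F :=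
  LinearMap.mk₂ ℂ (fun f α => ⟨_, mul_mem_repartitions f α.2⟩)
    (fun f g _ => Subtype.ext (funext fun _ => add_mul f g _))
    (fun c f _ => Subtype.ext (funext fun _ => smul_mul_assoc c f _))
    (fun f _ _ => Subtype.ext (funext fun _ => mul_add f _ _))
    (fun c f _ => Subtype.ext (funext fun _ => mul_smul_comm c f _))

@[simp] theorem mulRepartition_apply (f : F) (α : repartitions F) (P : Place F) :
    (mulRepartition f α : Place F → F) P = f * (α : Place F → F) P := rfl

theorem mulRepartition_mulRepartition (f g : F) (α : repartitions F) :
    mulRepartition f (mulRepartition g α) = mulRepartition (f * g) α :=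
  Subtype.ext (funext fun _ => (mul_assoc f g _).symm)

theorem mulRepartition_one (α : repartitions F) : mulRepartition 1 α = α :=
  Subtype.ext (funext fun _ => one_mul _)

/-- The Weil differentials that vanish on the repartitions bounded by `D`. -/
abbrev differentials (D : Divisor F) : Submodule ℂ (Module.Dual ℂ (repartitions F)) :=
  (trivialRepartitions D).dualAnnihilator

omit [IsFunctionField F] in
theorem finrank_differentials (D : Divisor F) :
    Module.finrank ℂ (differentials D) = Module.finrank ℂ (H1 D) := by
  rw [← Subspace.dual_finrank_eq (V := H1 D)]
  exact (Submodule.dualQuotEquivDualAnnihilator (trivialRepartitions D)).finrank_eq.symm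

instance finite_differentials (D : Divisor F) : Module.Finite ℂ (differentials D) :=
  Module.Finite.equiv (Submodule.dualQuotEquivDualAnnihilator (trivialRepartitions D))

theorem mul_mem_trivialRepartitions {D E : Divisor F} {f : F} (hf : f ∈ H0 (E - D))
    {α : repartitions F} (hα : α ∈ trivialRepartitions D) :
    mulRepartition f α ∈ trivialRepartitions E := by
  rw [mem_trivialRepartitions] at hα ⊢
  obtain ⟨g, hg⟩ := hα
  refine ⟨f * g, fun P => ?_⟩
  have := mul_mem_stalk (mem_H0.1 hf P) (hg P)
  rwa [Finsupp.sub_apply, sub_add_cancel, mul_sub] at this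

/-- Multiplication of a differential with divisor at least `E` by the sections of `𝒪(E - D)`. -/
def mulDifferential {D E : Divisor F} (ω : differentials E) : H0 (E - D) →ₗ[ℂ] differentials D :=
  LinearMap.codRestrict _
    (LinearMap.llcomp ℂ _ _ _ ω.1 ∘ₗ mulRepartition ∘ₗ (H0 (E - D)).subtype) fun f => by
    rw [Submodule.mem_dualAnnihilator]
    exact fun α hα => (Submodule.mem_dualAnnihilator _).1 ω.2 _
      (mul_mem_trivialRepartitions f.2 hα)

theorem mulDifferential_apply {D E : Divisor F} (ω : differentials E) (f : H0 (E - D))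
    (α : repartitions F) : (mulDifferential ω f).1 α = ω.1 (mulRepartition (f : F) α) := rfl

theorem eq_zero_of_forall_mulRepartition {ω : Module.Dual ℂ (repartitions F)} (hω : ω ≠ 0) {f : F}
    (h : ∀ α, ω (mulRepartition f α) = 0) : f = 0 := by
  by_contra hf
  refine hω (LinearMap.ext fun α => ?_)
  have := h (mulRepartition f⁻¹ α)
  rwa [mulRepartition_mulRepartition, mul_inv_cancel₀ hf, mulRepartition_one] at this

theorem mulDifferential_injective {D E : Divisor F} {ω : differentials E} (hω : ω ≠ 0) :
    Function.Injective (mulDifferential (D := D) ω) := by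
  rw [injective_iff_map_eq_zero]
  intro f hf
  refine Subtype.ext (eq_zero_of_forall_mulRepartition (ω := ω.1) (by simpa using hω) fun α => ?_)
  rw [← mulDifferential_apply, hf]
  rfl

omit [IsFunctionField F] in
theorem degree_nsmul_divisor (n : ℕ) (P : Place F) : (n • P.divisor).degree = n := by
  rw [map_nsmul, Place.divisor, Finsupp.degree_single, nsmul_eq_mul, mul_one]

/-- The space of Weil differentials has dimension one over the function field. -/
theorem exists_mul_eq_mul {D E : Divisor F} {ω : differentials E} {η : differentials D}
    (hω : ω ≠ 0) :
    ∃ f : F, ∀ α, η.1 α = ω.1 (mulRepartition f α) := by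
  obtain ⟨P⟩ := nonempty_place (F := F)
  -- With `B = -nP`, the source of `φ` has dimension at least `2n + deg D + deg E + 2 - 2g`, while
  -- the differentials for `B` have dimension at most `n + g`. For this `n` the map `(f, g) ↦ fω -
  -- gη` has a kernel, and a kernel element gives the ratio `η / ω`.
  obtain ⟨n, hn⟩ : ∃ n : ℕ, 3 * (genus F : ℤ) < n + E.degree + D.degree + 2 :=
    ⟨(3 * (genus F : ℤ) - E.degree - D.degree).toNat, by
      have := Int.self_le_toNat (3 * (genus F : ℤ) - E.degree - D.degree); linarith⟩
  let B : Divisor F := -(n • P.divisor)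
  let φ : H0 (E - B) × H0 (D - B) →ₗ[ℂ] differentials B :=
    (mulDifferential ω).coprod (-mulDifferential η)
  have hφ : ¬ Function.Injective φ := by
    intro hinj
    have hle := LinearMap.finrank_le_finrank_of_injective hinj
    rw [Module.finrank_prod, finrank_differentials] at hle
    have r1 := riemannRoch (E - B)
    have r2 := riemannRoch (D - B)
    have r3 := riemannRoch B
    have hB : B.degree = -n := by rw [map_neg, degree_nsmul_divisor]
    rw [map_sub, hB] at r1 r2
    rw [hB] at r3
    have h0 : Module.finrank ℂ (H0 B) ≤ 1 := by
      rw [← finrank_H0_zero (F := F)]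
      exact Submodule.finrank_mono
        (H0_mono (neg_nonpos.2 (nsmul_nonneg (Finsupp.single_nonneg.2 zero_le_one) n)))
    zify at hle h0
    linarith
  rw [injective_iff_map_eq_zero] at hφ
  push Not at hφ
  obtain ⟨⟨f, g⟩, hfg, hne⟩ := hφ
  have hmul : ∀ α, ω.1 (mulRepartition (f : F) α) = η.1 (mulRepartition (g : F) α) := fun α => by
    have := LinearMap.congr_fun (congrArg Subtype.val hfg) α
    simp only [φ, LinearMap.coprod_apply, LinearMap.neg_apply] at this
    rw [← sub_eq_zero, sub_eq_add_neg]
    exact this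
  have hg : (g : F) ≠ 0 := by
    intro hg
    refine hne (Prod.ext (Subtype.ext ?_) (Subtype.ext hg))
    refine eq_zero_of_forall_mulRepartition (ω := ω.1) (by simpa using hω) fun α => ?_
    rw [hmul, hg]
    simp
  refine ⟨f * (g : F)⁻¹, fun α => ?_⟩
  rw [← mulRepartition_mulRepartition, hmul, mulRepartition_mulRepartition, mul_inv_cancel₀ hg,
    mulRepartition_one]

theorem IsCanonical.exists_differential {W : Divisor F} (hW : IsCanonical W) :
    ∃ ω : differentials W, ω ≠ 0 ∧ ∀ D : Divisor F, ω.1 ∈ differentials D → D ≤ W := by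
  obtain ⟨ω, hω, hprin, hdiv⟩ := hW
  have hmem : ω ∈ differentials W := by
    rw [Submodule.mem_dualAnnihilator]
    intro α hα
    obtain ⟨f, hf⟩ := mem_trivialRepartitions.1 hα
    let γ : repartitions F := ⟨fun _ => f, const_mem_repartitions f⟩
    have h1 := (hdiv W).2 le_rfl (α - γ) (mem_boundedRepartitions.2 hf)
    have h2 := hprin γ (const_mem_principalRepartitions f)
    rwa [map_sub, h2, sub_zero] at h1
  refine ⟨⟨ω, hmem⟩, fun h => hω (congrArg Subtype.val h), fun D hD => (hdiv D).1 fun α hα => ?_⟩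
  exact (Submodule.mem_dualAnnihilator _).1 hD α
    (mem_trivialRepartitions.2 ⟨0, fun P => by simpa using mem_boundedRepartitions.1 hα P⟩)

/-- Serre duality. -/
theorem finrank_H1_eq {W : Divisor F} (hW : IsCanonical W) (D : Divisor F) :
    Module.finrank ℂ (H1 D) = Module.finrank ℂ (H0 (W - D)) := by
  obtain ⟨ω, hω, hmax⟩ := hW.exists_differential
  rw [← finrank_differentials]
  refine (LinearEquiv.finrank_eq (LinearEquiv.ofBijective (mulDifferential (D := D) ω)
    ⟨mulDifferential_injective hω, fun η => ?_⟩)).symm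
  rcases eq_or_ne η 0 with rfl | hη
  · exact ⟨0, map_zero _⟩
  obtain ⟨f, hf⟩ := exists_mul_eq_mul (η := η) hω
  have hf0 : f ≠ 0 := by
    rintro rfl
    refine hη (Subtype.ext (LinearMap.ext fun α => ?_))
    rw [hf]
    simp
  -- `ω = f⁻¹η` vanishes on repartitions bounded by `D - divisorOf f`, so maximality of `W` applies;
  -- it says that `f` is a section of `𝒪(W - D)`.
  have hle : D - divisorOf f ≤ W := by
    refine hmax _ ((Submodule.mem_dualAnnihilator _).2 fun α hα => ?_)
    have hinv : f⁻¹ ∈ H0 (D - (D - divisorOf f)) := mem_H0.2 fun P => by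
      rw [sub_sub_cancel, mem_stalk, map_inv₀, val_eq_exp_divisorOf hf0, ← WithZero.exp_neg,
        neg_neg]
    have := (Submodule.mem_dualAnnihilator _).1 η.2 _ (mul_mem_trivialRepartitions hinv hα)
    rwa [hf, mulRepartition_mulRepartition, mul_inv_cancel₀ hf0, mulRepartition_one] at this
  refine ⟨⟨f, mem_H0.2 fun P => (mem_stalk_iff_divisorOf hf0).2 ?_⟩, ?_⟩
  · have := hle P
    simp only [Finsupp.sub_apply] at this ⊢
    linarith
  · exact Subtype.ext (LinearMap.ext fun α => (hf α).symm)

theorem IsCanonical.degree_eq {W : Divisor F} (hW : IsCanonical W) :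
    W.degree = 2 * (genus F : ℤ) - 2 := by
  have h := riemannRoch W
  rw [finrank_H1_eq hW W, sub_self, finrank_H0_zero] at h
  have hg : Module.finrank ℂ (H0 W) = genus F := by
    rw [genus, finrank_H1_eq hW, sub_zero]
  rw [hg] at h
  push_cast at h
  linarith

theorem subsingleton_H1_of_degree {W : Divisor F} (hW : IsCanonical W) {D : Divisor F}
    (hD : 2 * (genus F : ℤ) - 2 < D.degree) : Subsingleton (H1 D) := by
  rw [← Module.finrank_zero_iff (R := ℂ), finrank_H1_eq hW, H0_eq_bot, finrank_bot]
  rw [map_sub, hW.degree_eq]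
  linarith

/-- If `H¹` vanishes, Riemann–Roch gives `h⁰ = deg + 1`, which cannot be negative; conversely the
canonical degree is `-2`. -/
theorem subsingleton_H1_iff_of_genus_eq_zero {W : Divisor F} (hW : IsCanonical W)
    (hg : genus F = 0) {D : Divisor F} : Subsingleton (H1 D) ↔ -1 ≤ D.degree := by
  refine ⟨fun h => ?_, fun h => subsingleton_H1_of_degree hW (by rw [hg]; push_cast; linarith)⟩
  have := riemannRoch D
  rw [Module.finrank_zero_of_subsingleton (M := H1 D), hg] at this
  push_cast at this
  linarith [(Module.finrank ℂ (H0 D)).cast_nonneg (α := ℤ)]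

omit [IsFunctionField F] in
/-- If `H¹(𝒪(E)) = 0` and `E ≤ D`, then sections of `𝒪(D)` can be prescribed modulo `𝒪(E)`. -/
theorem exists_section {D E : Divisor F} (hE : Subsingleton (H1 E)) (α : repartitions F)
    (hED : E ≤ D) (hα : ∀ P, (α : Place F → F) P ∈ stalk P (D P)) :
    ∃ s ∈ H0 D, ∀ P, s - (α : Place F → F) P ∈ stalk P (E P) := by
  obtain ⟨s, hs⟩ := mem_trivialRepartitions.1
    (show α ∈ trivialRepartitions E from subsingleton_H1_iff.1 hE ▸ Submodule.mem_top)
  have hs' : ∀ P, s - (α : Place F → F) P ∈ stalk P (E P) := fun P => by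
    rw [← neg_sub]
    exact (stalk P _).neg_mem (hs P)
  refine ⟨s, mem_H0.2 fun P => ?_, hs'⟩
  simpa using (stalk P (D P)).add_mem (stalk_mono P (hED P) (hs' P)) (hα P)

end Duality

end TameHitchin

end

noncomputable section

namespace TameHitchin

/-! ### Partial sums of partitions and vanishing orders. -/

section Partitions

variable {N : ℕ}

theorem part_antitone (O : Nat.Partition N) : Antitone (part O) := by
  have hs : (O.parts.sort (· ≥ ·)).Pairwise (· ≥ ·) := Multiset.pairwise_sort _ _
  intro i j hij
  unfold part
  generalize O.parts.sort (· ≥ ·) = l at hs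
  rcases lt_or_ge j l.length with hj | hj
  · rw [List.getD_eq_getElem _ _ hj, List.getD_eq_getElem _ _ (hij.trans_lt hj)]
    rcases hij.eq_or_lt with rfl | hlt
    · exact le_rfl
    · exact List.pairwise_iff_getElem.1 hs i j _ hj hlt
  · rw [List.getD_eq_default _ _ hj]
    exact Nat.zero_le _

/-- The number of boxes in the first `c` columns. -/
abbrev partSum (O : Nat.Partition N) (c : ℕ) : ℕ := ∑ i ∈ Finset.range c, part O i

theorem sum_range_getD (l : List ℕ) : ∑ i ∈ Finset.range l.length, l.getD i 0 = l.sum := by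
  induction l with
  | nil => simp
  | cons a l ih =>
    rw [List.length_cons, Finset.sum_range_succ', List.sum_cons, add_comm]
    congr 1

theorem exists_partSum_eq (O : Nat.Partition N) :
    ∃ M, partSum O M = N ∧ ∀ i, M ≤ i → part O i = 0 := by
  refine ⟨(O.parts.sort (· ≥ ·)).length, ?_, fun i hi => List.getD_eq_default _ _ hi⟩
  unfold partSum part
  rw [sum_range_getD, ← Multiset.sum_coe, Multiset.sort_eq, O.parts_sum]

theorem partSum_mono (O : Nat.Partition N) : Monotone (partSum O) := fun _ _ h =>
  Finset.sum_le_sum_of_subset (Finset.range_mono h)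

theorem partSum_le (O : Nat.Partition N) (c : ℕ) : partSum O c ≤ N := by
  obtain ⟨M, hM, h0⟩ := exists_partSum_eq O
  rcases le_total c M with h | h
  · exact (partSum_mono O h).trans hM.le
  · rw [partSum, ← Finset.sum_range_add_sum_Ico _ h, ← partSum, hM, Finset.sum_eq_zero, add_zero]
    exact fun i hi => h0 i (Finset.mem_Ico.1 hi).1

theorem partSum_eq_of_part_eq_zero (O : Nat.Partition N) {c : ℕ} (h : part O c = 0) :
    partSum O c = N := by
  obtain ⟨M, hM, -⟩ := exists_partSum_eq O
  refine le_antisymm (partSum_le O c) ?_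
  rcases le_total M c with h' | h'
  · exact hM.ge.trans (partSum_mono O h')
  · refine hM.ge.trans (le_of_eq ?_)
    rw [partSum, ← Finset.sum_range_add_sum_Ico _ h', Finset.sum_eq_zero (s := Finset.Ico c M),
      add_zero]
    exact fun i hi => Nat.le_zero.1 (h ▸ part_antitone O (Finset.mem_Ico.1 hi).1)

/-- Until all boxes are used, each further column contains at least one. -/
theorem min_le_partSum_add (O : Nat.Partition N) (c m : ℕ) :
    min N (partSum O c + m) ≤ partSum O (c + m) := by
  induction m with
  | zero => simp
  | succ m ih =>
    rcases Nat.eq_zero_or_pos (part O (c + m)) with h | h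
    · have := partSum_eq_of_part_eq_zero O h
      have := partSum_mono O (show c + m ≤ c + (m + 1) by omega)
      omega
    · have : partSum O (c + (m + 1)) = partSum O (c + m) + part O (c + m) :=
        Finset.sum_range_succ _ _
      omega

theorem partSum_add_le (O : Nat.Partition N) {c : ℕ} (h : part O c ≤ 1) (m : ℕ) :
    partSum O (c + m) ≤ partSum O c + m := by
  induction m with
  | zero => simp
  | succ m ih =>
    have : partSum O (c + (m + 1)) = partSum O (c + m) + part O (c + m) :=
      Finset.sum_range_succ _ _
    have := part_antitone O (show c ≤ c + m by omega)
    omega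

/-- The adjunction with partial sums through which vanishing orders are computed. The bound `k ≤ N`
matters: beyond it the set of admissible `c` is empty and the infimum is the default `0`. -/
theorem vanishingOrder_le_iff (O : Nat.Partition N) {k : ℕ} (hk : k ≤ N) {c : ℕ} :
    vanishingOrder O k ≤ c ↔ k ≤ partSum O c := by
  have hne : {c : ℕ | k ≤ ∑ i ∈ Finset.range c, part O i}.Nonempty := by
    obtain ⟨M, hM, -⟩ := exists_partSum_eq O
    exact ⟨M, hk.trans hM.ge⟩
  constructor
  · intro h
    exact le_trans (b := partSum O (vanishingOrder O k)) (Nat.sInf_mem hne) (partSum_mono O h)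
  · exact fun h => Nat.sInf_le h

theorem vanishingOrder_lt {O : Nat.Partition N} (hO : IsNonzeroOrbit O) {k : ℕ} (h2 : 2 ≤ k)
    (hk : k ≤ N) : vanishingOrder O k < k := by
  have h : vanishingOrder O k ≤ 1 + (k - 2) := by
    rw [vanishingOrder_le_iff O hk]
    refine le_trans ?_ (min_le_partSum_add O 1 (k - 2))
    have h1 : partSum O 1 = part O 0 := Finset.sum_range_one _
    have h3 : 2 ≤ part O 0 := hO
    omega
  omega

theorem vanishingOrder_add_one_le (O : Nat.Partition N) {k : ℕ} (hk : k + 1 ≤ N) :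
    vanishingOrder O (k + 1) ≤ vanishingOrder O k + 1 := by
  rw [vanishingOrder_le_iff O hk]
  have h1 := (vanishingOrder_le_iff O (k := k) (by omega)).1 le_rfl
  have h2 := min_le_partSum_add O (vanishingOrder O k) 1
  omega

/-- Once the columns have height at most one, every new box opens a new column. -/
theorem vanishingOrder_eq_add {O : Nat.Partition N} {c t k : ℕ} (hc : partSum O c = t)
    (hpart : part O c ≤ 1) (htk : t < k) (hk : k ≤ N) :
    vanishingOrder O k = c + (k - t) := by
  refine le_antisymm ?_ (not_lt.1 fun h => ?_)
  · rw [vanishingOrder_le_iff O hk]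
    have := min_le_partSum_add O c (k - t)
    omega
  · have h' : vanishingOrder O k ≤ c + (k - t - 1) := by omega
    rw [vanishingOrder_le_iff O hk] at h'
    have := partSum_add_le O hpart (k - t - 1)
    omega

theorem mul_part_le_partSum (O : Nat.Partition N) (c : ℕ) : c * part O c ≤ partSum O c := by
  have := Finset.card_nsmul_le_sum (Finset.range c) (part O) (part O c) fun i hi =>
    part_antitone O (Finset.mem_range.1 hi).le
  simpa using this

theorem getD_filter_ne_zero {l : List ℕ} (hl : l.Pairwise (· ≥ ·)) (i : ℕ) :
    (l.filter (· ≠ 0)).getD i 0 = l.getD i 0 := by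
  induction l generalizing i with
  | nil => rfl
  | cons a l ih =>
    rw [List.pairwise_cons] at hl
    rcases Nat.eq_zero_or_pos a with rfl | ha
    · have h0 : ∀ b ∈ l, b = 0 := fun b hb => Nat.le_zero.1 (hl.1 b hb)
      have hnil : (0 :: l).filter (· ≠ 0) = [] := by simpa using h0
      rw [hnil]
      cases i with
      | zero => rfl
      | succ i => rw [List.getD_cons_succ, ← ih hl.2, List.filter_eq_nil_iff.2 (by simpa using h0)]; rfl
    · rw [List.filter_cons_of_pos (by simpa using ha.ne')]
      cases i with
      | zero => rfl
      | succ i => rw [List.getD_cons_succ, List.getD_cons_succ, ih hl.2]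

theorem exists_partition_of_antitone {f : ℕ → ℕ} (hf : Antitone f) {M : ℕ}
    (hsum : ∑ i ∈ Finset.range M, f i = N) (h0 : ∀ i, M ≤ i → f i = 0) :
    ∃ O : Nat.Partition N, ∀ i, part O i = f i := by
  let l := (List.range M).map f
  have hl : l.Pairwise (· ≥ ·) :=
    List.pairwise_map.2 (List.pairwise_lt_range.imp fun h => hf h.le)
  let O : Nat.Partition N := Nat.Partition.ofSums N (l : Multiset ℕ) hsum
  have hO : O.parts.sort (· ≥ ·) = l.filter (· ≠ 0) := by
    change ((l : Multiset ℕ).filter (· ≠ 0)).sort (· ≥ ·) = _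
    rw [Multiset.filter_coe, Multiset.coe_sort]
    exact List.mergeSort_of_pairwise (by simpa using hl.filter _)
  refine ⟨O, fun i => ?_⟩
  rw [part, hO, getD_filter_ne_zero hl]
  rcases lt_or_ge i M with h | h
  · simp [l, h]
  · rw [h0 i h, List.getD_eq_default _ _ (by simpa [l] using h)]

end Partitions

/-! ### Degrees on a rational component and the orbit at the node. -/

section Combinatorics

variable {N : ℕ} {ι : Type*} [Fintype ι]

/-- The degree on a rational component with one node, marked by the orbits `O i`, of the
restriction of `L_k`. -/
def orbitDegree (O : ι → Nat.Partition N) (k : ℕ) : ℤ :=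
  ∑ i, ((k : ℤ) - vanishingOrder (O i) k) - k

/-- Beyond `t` every orbit other than `O j` gains one column per box, so `k - χ_k` stays constant
and `d_k = c_j - χ_k(O_j)`. Merging the columns of `O j` with indices `0` to `c_j` shifts its
vanishing orders by `c_j`, which turns them into `-d_k`. -/
theorem exists_orbit_of_tail [DecidableEq ι] {O : ι → Nat.Partition N} {t : ℕ} {c : ι → ℕ}
    (hc : ∀ i, partSum (O i) (c i) = t) (hdt : ∑ i, ((t : ℤ) - c i) = t) (j : ι)
    (hj : ∀ i, i ≠ j → part (O i) (c i) ≤ 1) :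
    ∃ O' : Nat.Partition N, part O' 0 = t + part (O j) (c j) ∧
      part O' 1 = part (O j) (c j + 1) ∧
      (∀ k ∈ Finset.Icc 1 N, k ≤ t → vanishingOrder O' k = 1) ∧
      ∀ k, t < k → k ≤ N → orbitDegree O k < 0 ∧
        vanishingOrder O' k = 1 + (-1 - orbitDegree O k).toNat := by
  obtain ⟨M, hM, hM0⟩ := exists_partSum_eq (O j)
  let f : ℕ → ℕ := fun i => if i = 0 then t + part (O j) (c j) else part (O j) (c j + i)
  have hfsum : ∀ m, ∑ i ∈ Finset.range (m + 1), f i = partSum (O j) (c j + m + 1) := by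
    intro m
    induction m with
    | zero => simp [f, partSum, Finset.sum_range_succ, ← hc j]
    | succ m ih =>
      rw [Finset.sum_range_succ, ih, partSum, partSum, Finset.sum_range_succ _ (c j + (m + 1))]
      simp [f, add_assoc]
  obtain ⟨O', hO'⟩ : ∃ O' : Nat.Partition N, ∀ i, part O' i = f i := by
    refine exists_partition_of_antitone (M := M + 1) ?_ ?_ ?_
    · refine antitone_nat_of_succ_le fun n => ?_
      simp only [f]
      have := part_antitone (O j) (show c j + n ≤ c j + (n + 1) by omega)
      rcases Nat.eq_zero_or_pos n with rfl | hn
      · simp at this ⊢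
        omega
      · simpa [hn.ne'] using this
    · rw [hfsum]
      exact le_antisymm (partSum_le _ _) (hM.ge.trans (partSum_mono _ (by omega)))
    · intro i hi
      simp [f, show i ≠ 0 by omega, hM0 (c j + i) (by omega)]
  have hsum : ∀ m, partSum O' (m + 1) = partSum (O j) (c j + m + 1) := fun m => by
    rw [← hfsum, partSum]
    exact Finset.sum_congr rfl fun i _ => hO' i
  have hχ : ∀ k ≤ N, ∀ m, vanishingOrder O' k ≤ m + 1 ↔ vanishingOrder (O j) k ≤ c j + m + 1 :=
    fun k hk m => by rw [vanishingOrder_le_iff _ hk, vanishingOrder_le_iff _ hk, hsum]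
  have hpos : ∀ k, 1 ≤ k → k ≤ N → 1 ≤ vanishingOrder O' k := fun k h1 hk => by
    by_contra! h
    have := (vanishingOrder_le_iff O' hk (c := 0)).1 (by omega)
    simp [partSum] at this
    omega
  refine ⟨O', hO' 0, hO' 1, fun k hk hkt => ?_, fun k htk hk => ?_⟩
  · rw [Finset.mem_Icc] at hk
    refine le_antisymm ?_ (hpos k hk.1 hk.2)
    rw [hχ k hk.2 0, vanishingOrder_le_iff _ hk.2]
    have := partSum_mono (O j) (show c j ≤ c j + 0 + 1 by omega)
    rw [hc] at this
    omega
  · have hgt : c j < vanishingOrder (O j) k := by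
      by_contra! h
      rw [vanishingOrder_le_iff _ hk, hc] at h
      omega
    have hd : orbitDegree O k = c j - vanishingOrder (O j) k := by
      have h1 : ∀ i ∈ Finset.univ.erase j,
          (k : ℤ) - vanishingOrder (O i) k = t - c i := fun i hi => by
        rw [vanishingOrder_eq_add (hc i) (hj i (Finset.ne_of_mem_erase hi)) htk hk]
        push_cast [Nat.cast_sub htk.le]
        ring
      rw [orbitDegree, ← Finset.add_sum_erase _ _ (Finset.mem_univ j), Finset.sum_congr rfl h1]
      rw [← Finset.add_sum_erase _ _ (Finset.mem_univ j)] at hdt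
      linarith
    refine ⟨by omega, ?_⟩
    obtain ⟨e, he⟩ : ∃ e, vanishingOrder (O j) k = c j + e + 1 :=
      ⟨vanishingOrder (O j) k - c j - 1, by omega⟩
    have h1 : vanishingOrder O' k ≤ e + 1 := (hχ k hk e).2 he.le
    have h2 : e + 1 ≤ vanishingOrder O' k := by
      by_contra! h
      have hp := hpos k (by omega) hk
      have := (hχ k hk (vanishingOrder O' k - 1)).1 (by omega)
      omega
    rw [hd, he]
    push_cast
    omega

theorem orbitDegree_of_parts_two [DecidableEq ι] {O : ι → Nat.Partition N} {i j : ι} (hij : i ≠ j)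
    (hall : ∀ x, x = i ∨ x = j) {a : ℕ} (ha : ∀ x, ∀ m < a, part (O x) m = 2) {k : ℕ}
    (hk : k ≤ 2 * a) : orbitDegree O k = k - 2 * ((k + 1) / 2 : ℕ) := by
  have hsum : ∀ x, ∀ m ≤ a, partSum (O x) m = 2 * m := fun x m hm => by
    rw [partSum, Finset.sum_congr rfl fun n hn => ha x n ((Finset.mem_range.1 hn).trans_le hm)]
    simp [mul_comm]
  have hkN : k ≤ N := hk.trans (hsum i a le_rfl ▸ partSum_le _ _)
  have hχ : ∀ x, vanishingOrder (O x) k = (k + 1) / 2 := fun x => by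
    refine le_antisymm ?_ (not_lt.1 fun h => ?_)
    · rw [vanishingOrder_le_iff _ hkN, hsum x _ (by omega)]
      omega
    · have h' : vanishingOrder (O x) k ≤ (k + 1) / 2 - 1 := by omega
      rw [vanishingOrder_le_iff _ hkN, hsum x _ (by omega)] at h'
      omega
  have huniv : (Finset.univ : Finset ι) = {i, j} := by
    ext x
    simpa using hall x
  rw [orbitDegree, huniv, Finset.sum_pair hij, hχ, hχ]
  push_cast
  ring

/-- The possible shapes of the degrees `d k` on a rational component that are negative somewhere:
they are nonnegative exactly up to `t`, or exactly in the even degrees up to `t`, and the excess of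
`-d k` over `1` is recorded by the vanishing orders of `O'`. -/
def IsRestrictedShape (N : ℕ) (d : ℕ → ℤ) (O' : Nat.Partition N) (t q : ℕ) : Prop :=
  2 ≤ t ∧ t ≤ N ∧ part O' 0 = t + q ∧ part O' 1 ≤ q ∧ q ≤ t ∧
  (∀ k ∈ Finset.Icc 2 N, vanishingOrder O' k = 1 + (-1 - d k).toNat) ∧
  ((t < N ∧ 1 ≤ q ∧ ∀ k ∈ Finset.Icc 2 N, 0 ≤ d k ↔ k ≤ t) ∨
    (Even t ∧ q ≤ 2 ∧ ∀ k ∈ Finset.Icc 2 N, 0 ≤ d k ↔ Even k ∧ k ≤ t))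

/-- Up to `2a` both orbits consist of columns of height `2`, and `d` is `0` in even and `-1` in odd
degrees; neither value requires a twist. From `2a` on, `O i` has columns of height at most one, and
the tail construction applies to `O j`. -/
theorem exists_shape_of_parts_two [DecidableEq ι] {O : ι → Nat.Partition N} {i j : ι} (hij : i ≠ j)
    (hall : ∀ x, x = i ∨ x = j) {a : ℕ} (ha1 : 1 ≤ a) (ha : ∀ x, ∀ m < a, part (O x) m = 2)
    (hi : part (O i) a ≤ 1) : ∃ O' t q, IsRestrictedShape N (orbitDegree O) O' t q := by
  have hsum : ∀ x, partSum (O x) a = 2 * a := fun x => by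
    rw [partSum, Finset.sum_congr rfl fun n hn => ha x n (Finset.mem_range.1 hn)]
    simp [mul_comm]
  have huniv : (Finset.univ : Finset ι) = {i, j} := by
    ext x
    simpa using hall x
  obtain ⟨O', h0, h1, hle, hgt⟩ := exists_orbit_of_tail (O := O) (c := fun _ => a) (t := 2 * a)
    hsum (by rw [huniv, Finset.sum_pair hij]; push_cast; ring) j
    (fun x hx => by rw [(hall x).resolve_right hx]; exact hi)
  have hq : part (O j) a ≤ 2 := ha j 0 ha1 ▸ part_antitone (O j) (Nat.zero_le a)
  refine ⟨O', 2 * a, part (O j) a, by omega, hsum i ▸ partSum_le _ _, h0,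
    h1 ▸ part_antitone (O j) (Nat.le_succ a), by omega, fun k hk => ?_,
    Or.inr ⟨even_two_mul a, hq, fun k hk => ?_⟩⟩
  · rw [Finset.mem_Icc] at hk
    rcases le_or_gt k (2 * a) with h | h
    · rw [hle k (Finset.mem_Icc.2 ⟨by omega, hk.2⟩) h, orbitDegree_of_parts_two hij hall ha h]
      omega
    · exact (hgt k h hk.2).2
  · rw [Finset.mem_Icc] at hk
    rcases le_or_gt k (2 * a) with h | h
    · rw [orbitDegree_of_parts_two hij hall ha h, Nat.even_iff]
      omega
    · have := (hgt k h hk.2).1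
      rw [Nat.even_iff]
      omega

theorem exists_restrictedShape {O : ι → Nat.Partition N} (hcard : 2 ≤ Fintype.card ι)
    (hO : ∀ i, IsNonzeroOrbit (O i)) (hneg : ∃ k ∈ Finset.Icc 2 N, orbitDegree O k < 0) :
    ∃ O' t q, IsRestrictedShape N (orbitDegree O) O' t q := by
  classical
  have hex : ∃ k, (2 ≤ k ∧ k ≤ N) ∧ orbitDegree O k < 0 := by simpa using hneg
  obtain ⟨⟨h2, hN⟩, hlt⟩ := Nat.find_spec hex
  have hmin : ∀ k, 2 ≤ k → k < Nat.find hex → 0 ≤ orbitDegree O k := fun k hk hlt => by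
    by_contra! h
    exact Nat.find_min hex hlt ⟨⟨hk, by omega⟩, h⟩
  obtain ⟨t, ht⟩ : ∃ t, Nat.find hex = t + 1 := ⟨Nat.find hex - 1, by omega⟩
  rw [ht] at h2 hN hlt hmin
  -- Each of the at least two nonzero orbits contributes at least `1`.
  have hd2 : 0 ≤ orbitDegree O 2 := by
    have h1 : ∀ i ∈ Finset.univ, (1 : ℤ) ≤ ((2 : ℕ) : ℤ) - vanishingOrder (O i) 2 := fun i _ => by
      have := vanishingOrder_lt (hO i) le_rfl (by omega : 2 ≤ N)
      omega
    have := Finset.card_nsmul_le_sum _ _ _ h1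
    rw [Finset.card_univ, nsmul_eq_mul, mul_one] at this
    rw [orbitDegree]
    omega
  have ht2 : 2 ≤ t := by
    by_contra! h
    rw [show t + 1 = 2 by omega] at hlt
    omega
  have hdt : 0 ≤ orbitDegree O t := hmin t ht2 (by omega)
  have hstep : ∀ i, vanishingOrder (O i) (t + 1) ≤ vanishingOrder (O i) t + 1 := fun i =>
    vanishingOrder_add_one_le _ hN
  -- No summand decreases, so `d` falls by at most one. Crossing from `d_t ≥ 0` to `d_{t+1} < 0`
  -- thus forces `d_t = 0` and equality in every summand: each orbit starts a new column at box `t +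
  -- 1`.
  have hterm : ∀ i ∈ Finset.univ, (t : ℤ) - vanishingOrder (O i) t ≤
      ((t + 1 : ℕ) : ℤ) - vanishingOrder (O i) (t + 1) := fun i _ => by
    have := hstep i
    omega
  have hsumle := Finset.sum_le_sum hterm
  have hd0 : ∑ i, ((t : ℤ) - vanishingOrder (O i) t) = t := by
    rw [orbitDegree] at hdt hlt
    push_cast at *
    omega
  have hjump : ∀ i, vanishingOrder (O i) (t + 1) = vanishingOrder (O i) t + 1 := by
    have heq := (Finset.sum_eq_sum_iff_of_le hterm).1 (by
      rw [orbitDegree] at hdt hlt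
      push_cast at *
      omega)
    intro i
    have := heq i (Finset.mem_univ i)
    omega
  obtain ⟨c, hcdef⟩ : ∃ c : ι → ℕ, ∀ i, vanishingOrder (O i) t = c i := ⟨_, fun _ => rfl⟩
  simp only [hcdef] at hd0 hjump
  have hc : ∀ i, partSum (O i) (c i) = t := fun i => by
    refine le_antisymm ?_ ((vanishingOrder_le_iff _ (by omega)).1 (hcdef i).le)
    by_contra! h
    have := (vanishingOrder_le_iff (O i) hN).2 (show t + 1 ≤ partSum (O i) (c i) from h)
    have := hjump i
    omega
  by_cases htwo : ∃ i j, i ≠ j ∧ 2 ≤ part (O i) (c i) ∧ 2 ≤ part (O j) (c j)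
  · obtain ⟨i, j, hij, hi, hj⟩ := htwo
    -- All columns up to this one have height at least `2`, so `t - c_x ≥ t / 2`. Two such terms
    -- already exhaust `∑ (t - c_x) = t`, leaving no room for a third orbit, whose term would be
    -- positive, and forcing equality.
    have hhalf : ∀ x, 2 ≤ part (O x) (c x) → 2 * c x ≤ t := fun x hx => by
      have := mul_part_le_partSum (O x) (c x)
      rw [hc] at this
      nlinarith
    have hj' : j ∈ Finset.univ.erase i := Finset.mem_erase.2 ⟨hij.symm, Finset.mem_univ j⟩
    have hrest : ∀ x ∈ (Finset.univ.erase i).erase j, (1 : ℤ) ≤ (t : ℤ) - c x := fun x _ => by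
      have := hcdef x ▸ vanishingOrder_lt (hO x) ht2 (by omega)
      omega
    have hcr := Finset.card_nsmul_le_sum _ _ _ hrest
    rw [← Finset.add_sum_erase _ _ (Finset.mem_univ i), ← Finset.add_sum_erase _ _ hj'] at hd0
    rw [nsmul_eq_mul, mul_one] at hcr
    have hi2 := hhalf i hi
    have hj2 := hhalf j hj
    have hci : 2 * c i = t := by omega
    have hcj : 2 * c j = t := by omega
    have hempty : (Finset.univ.erase i).erase j = ∅ := by
      rw [← Finset.card_eq_zero]
      omega
    have hall : ∀ x, x = i ∨ x = j := fun x => by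
      by_contra! h
      have : x ∈ (Finset.univ.erase i).erase j := by simp [h]
      simp [hempty] at this
    have hpart0 : ∀ x, 2 ≤ part (O x) (c x) → 2 * c x = t → part (O x) 0 = 2 := by
      intro x hx hcx
      by_contra h0
      have h3 := part_antitone (O x) (Nat.zero_le (c x))
      have : ∑ _m ∈ Finset.range (c x), 2 < partSum (O x) (c x) :=
        Finset.sum_lt_sum
          (fun m hm => hx.trans (part_antitone (O x) (Finset.mem_range.1 hm).le))
          ⟨0, Finset.mem_range.2 (by omega), by omega⟩
      rw [hc, Finset.sum_const, Finset.card_range, smul_eq_mul] at this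
      omega
    have hp : ∀ x, part (O x) 0 = 2 := fun x => by
      rcases hall x with rfl | rfl
      · exact hpart0 _ hi hci
      · exact hpart0 _ hj hcj
    -- The first crossing `t` is now discarded: what matters is where one of the two orbits first
    -- runs out of columns of height `2`.
    have hexa : ∃ m, ∃ x, part (O x) m ≤ 1 := by
      obtain ⟨M, -, hM⟩ := exists_partSum_eq (O i)
      exact ⟨M, i, by rw [hM M le_rfl]; omega⟩
    obtain ⟨x, hx⟩ := Nat.find_spec hexa
    have ha : ∀ y, ∀ m < Nat.find hexa, part (O y) m = 2 := fun y m hm => by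
      have h1 := Nat.find_min hexa hm
      push Not at h1
      have := h1 y
      have := hp y ▸ part_antitone (O y) (Nat.zero_le m)
      omega
    have ha1 : 1 ≤ Nat.find hexa := by
      by_contra! h
      have h0 : Nat.find hexa = 0 := by omega
      rw [h0, hp] at hx
      omega
    rcases hall x with rfl | rfl
    · exact exists_shape_of_parts_two hij hall ha1 ha hx
    · exact exists_shape_of_parts_two hij.symm (fun y => (hall y).symm) ha1 ha hx
  · push Not at htwo
    obtain ⟨j, hj⟩ : ∃ j, ∀ i, i ≠ j → part (O i) (c i) ≤ 1 := by
      by_cases h : ∃ j, 2 ≤ part (O j) (c j)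
      · obtain ⟨j, hj⟩ := h
        exact ⟨j, fun i hij => by have := htwo j i hij.symm hj; omega⟩
      · push Not at h
        have : Nonempty ι := Fintype.card_pos_iff.1 (by omega)
        exact ⟨Classical.arbitrary ι, fun i _ => by have := h i; omega⟩
    obtain ⟨O', h0, h1, hle, hgt⟩ := exists_orbit_of_tail hc hd0 j hj
    refine ⟨O', t, part (O j) (c j), ht2, by omega, h0, h1 ▸ part_antitone (O j) (Nat.le_succ _),
      ?_, fun k hk => ?_, Or.inl ⟨by omega, ?_, fun k hk => ?_⟩⟩
    · have hcj : 1 ≤ c j := by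
        by_contra! h
        have h0 : c j = 0 := by omega
        have := hc j
        rw [h0] at this
        simp [partSum] at this
        omega
      have := mul_part_le_partSum (O j) (c j)
      rw [hc] at this
      nlinarith
    · rw [Finset.mem_Icc] at hk
      rcases le_or_gt k t with h | h
      · rw [hle k (Finset.mem_Icc.2 ⟨by omega, hk.2⟩) h]
        have := hmin k hk.1 (by omega)
        omega
      · exact (hgt k h hk.2).2
    · by_contra! h
      have := partSum_eq_of_part_eq_zero (O j) (show part (O j) (c j) = 0 by omega)
      rw [hc] at this
      omega
    · rw [Finset.mem_Icc] at hk
      rcases le_or_gt k t with h | h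
      · exact ⟨fun _ => h, fun _ => hmin k hk.1 (by omega)⟩
      · have := (hgt k h hk.2).1
        omega

end Combinatorics

end TameHitchin

end

noncomputable section

namespace TameHitchin

/-! ### Prescribing values of sections at points. -/

section Evaluation

variable {F : Type u} [Field F] [Algebra ℂ F]

theorem sub_divisor_same (D : Divisor F) (P : Place F) : (D - P.divisor) P = D P - 1 := by
  simp [Place.divisor]

theorem sub_divisor_of_ne (D : Divisor F) {P Q : Place F} (h : Q ≠ P) :
    (D - P.divisor) Q = D Q := by
  simp [Place.divisor, h.symm]

theorem sub_divisor_le (D : Divisor F) (P : Place F) : D - P.divisor ≤ D :=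
  sub_le_self _ (Finsupp.single_nonneg.2 zero_le_one)

theorem mk_fiber_eq_zero_iff {P : Place F} {n : ℤ} {f : stalk P n} :
    (Submodule.Quotient.mk f : Fiber P n) = 0 ↔ (f : F) ∈ stalk P (n - 1) := by
  rw [Submodule.Quotient.mk_eq_zero, Submodule.mem_comap, Submodule.subtype_apply]

theorem evalAt_eq_zero_iff {D : Divisor F} {P : Place F} {s : H0 D} :
    evalAt D P s = 0 ↔ (s : F) ∈ H0 (D - P.divisor) := by
  refine Iff.trans mk_fiber_eq_zero_iff ⟨fun h => mem_H0.2 fun Q => ?_, fun h => ?_⟩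
  · rcases eq_or_ne Q P with rfl | hQ
    · rw [sub_divisor_same]
      exact h
    · rw [sub_divisor_of_ne D hQ]
      exact mem_H0.1 s.2 Q
  · have := mem_H0.1 h P
    rw [sub_divisor_same] at this
    exact this

/-- A section with prescribed values at two points. -/
theorem exists_evalAt_eq_and_evalAt_eq {D : Divisor F} {P Q : Place F} (hPQ : P ≠ Q)
    (hD : Subsingleton (H1 (D - P.divisor - Q.divisor))) (v : Fiber P (D P)) (w : Fiber Q (D Q)) :
    ∃ s : H0 D, evalAt D P s = v ∧ evalAt D Q s = w := by
  obtain ⟨f, rfl⟩ := Submodule.Quotient.mk_surjective _ v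
  obtain ⟨g, rfl⟩ := Submodule.Quotient.mk_surjective _ w
  let α := singleRepartition P (f : F) + singleRepartition Q (g : F)
  have hαP : (α : Place F → F) P = f := by simp [α, singleRepartition_of_ne hPQ]
  have hαQ : (α : Place F → F) Q = g := by simp [α, singleRepartition_of_ne hPQ.symm]
  obtain ⟨s, hs, hsα⟩ := exists_section hD α ((sub_divisor_le _ _).trans (sub_divisor_le _ _))
    fun R => by
      rcases eq_or_ne R P with rfl | hRP
      · rw [hαP]
        exact f.2
      rcases eq_or_ne R Q with rfl | hRQ
      · rw [hαQ]
        exact g.2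
      simp [α, singleRepartition_of_ne hRP, singleRepartition_of_ne hRQ]
  refine ⟨⟨s, hs⟩, ?_, ?_⟩
  · refine sub_eq_zero.1 (mk_fiber_eq_zero_iff.2 ?_)
    have := hsα P
    rwa [hαP, sub_divisor_of_ne _ hPQ, sub_divisor_same] at this
  · refine sub_eq_zero.1 (mk_fiber_eq_zero_iff.2 ?_)
    have := hsα Q
    rwa [hαQ, sub_divisor_same, sub_divisor_of_ne _ hPQ.symm] at this

/-- A section with a prescribed value at a point. -/
theorem exists_evalAt_eq {D : Divisor F} {P : Place F} (hD : Subsingleton (H1 (D - P.divisor)))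
    (v : Fiber P (D P)) : ∃ s : H0 D, evalAt D P s = v := by
  obtain ⟨f, rfl⟩ := Submodule.Quotient.mk_surjective _ v
  obtain ⟨s, hs, hsα⟩ := exists_section hD (singleRepartition P f) (sub_divisor_le _ _) fun R => by
    rcases eq_or_ne R P with rfl | hRP
    · rw [singleRepartition_same]
      exact f.2
    · simp [singleRepartition_of_ne hRP]
  refine ⟨⟨s, hs⟩, sub_eq_zero.1 (mk_fiber_eq_zero_iff.2 ?_)⟩
  have := hsα P
  rwa [singleRepartition_same, sub_divisor_same] at this

/-- The fibre of a line bundle at a point is one-dimensional. -/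
theorem exists_fiber_generator [IsFunctionField F] (P : Place F) (n : ℤ) :
    ∃ e : Fiber P n, e ≠ 0 ∧ ∀ v : Fiber P n, ∃ c : ℂ, v = c • e := by
  obtain ⟨g, hg⟩ := P.exists_val_eq n
  refine ⟨Submodule.Quotient.mk ⟨g, hg.le⟩, fun h => ?_, fun v => ?_⟩
  · have := mk_fiber_eq_zero_iff.1 h
    rw [mem_stalk, hg, WithZero.exp_le_exp] at this
    omega
  · obtain ⟨f, rfl⟩ := Submodule.Quotient.mk_surjective _ v
    obtain ⟨c, hc⟩ := P.exists_sub_smul_mem f.2 hg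
    exact ⟨c, sub_eq_zero.1 (mk_fiber_eq_zero_iff.2 hc)⟩

theorem finrank_quotient_comap_eq_one {K M : Type*} [Field K] [AddCommGroup M] [Module K M]
    {U V : Submodule K M} {w : M} (hw : w ∈ U) (hwV : w ∉ V)
    (h : ∀ x ∈ U, ∃ c : K, x - c • w ∈ V) :
    Module.finrank K (U ⧸ V.comap U.subtype) = 1 := by
  refine finrank_eq_one (Submodule.Quotient.mk ⟨w, hw⟩) (fun h0 => hwV ?_) fun x => ?_
  · rwa [Submodule.Quotient.mk_eq_zero] at h0
  · obtain ⟨x, rfl⟩ := Submodule.Quotient.mk_surjective _ x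
    obtain ⟨c, hc⟩ := h x x.2
    refine ⟨c, (sub_eq_zero.1 ?_).symm⟩
    rw [← Submodule.Quotient.mk_smul, ← Submodule.Quotient.mk_sub, Submodule.Quotient.mk_eq_zero]
    exact hc

theorem finrank_quotient_comap_eq_zero {K M : Type*} [Field K] [AddCommGroup M] [Module K M]
    {U V : Submodule K M} (h : U ≤ V) : Module.finrank K (U ⧸ V.comap U.subtype) = 0 := by
  have : V.comap U.subtype = ⊤ := Submodule.comap_subtype_eq_top.2 h
  have : Subsingleton (U ⧸ V.comap U.subtype) := Submodule.Quotient.subsingleton_iff.2 this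
  exact Module.finrank_zero_of_subsingleton

end Evaluation

/-! ### Center parameters in terms of cohomology. -/

section CenterDim

variable {N : ℕ}

theorem SeparatingNode.mem_base {C : SeparatingNode.{u} N} {k : ℕ} {x : C.left.K × C.right.K} :
    x ∈ C.base k ↔ ∃ (a : H0 (C.bundleL' k)) (b : H0 (C.bundleR' k)),
      C.gluing k (evalAt _ C.pL a) = evalAt _ C.pR b ∧ ((a : C.left.K), (b : C.right.K)) = x := by
  rw [SeparatingNode.base, Submodule.mem_map]
  constructor
  · rintro ⟨⟨a, b⟩, h, rfl⟩
    exact ⟨a, b, h, rfl⟩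
  · rintro ⟨a, b, h, rfl⟩
    exact ⟨(a, b), h, rfl⟩

/-- Both evaluations at the node are surjective, so the common value is a free parameter in a
one-dimensional fibre; `splitBase` is where it vanishes. -/
theorem SeparatingNode.centerDim_eq_one (C : SeparatingNode.{u} N) {k : ℕ}
    (hL : Subsingleton (H1 (C.bundleL' k - C.pL.divisor)))
    (hR : Subsingleton (H1 (C.bundleR' k - C.pR.divisor))) : C.centerDim k = 1 := by
  obtain ⟨e, he, hgen⟩ := exists_fiber_generator C.pL (C.bundleL' k C.pL)
  obtain ⟨s, hs⟩ := exists_evalAt_eq hL e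
  obtain ⟨t, ht⟩ := exists_evalAt_eq hR (C.gluing k e)
  refine finrank_quotient_comap_eq_one (w := ((s : C.left.K), (t : C.right.K)))
    (SeparatingNode.mem_base.2 ⟨s, t, by rw [hs, ht], rfl⟩) (fun h => he ?_) fun x hx => ?_
  · rw [← hs]
    exact evalAt_eq_zero_iff.2 h.1
  · obtain ⟨a, b, hab, rfl⟩ := SeparatingNode.mem_base.1 hx
    obtain ⟨c, hc⟩ := hgen (evalAt _ C.pL a)
    refine ⟨c, evalAt_eq_zero_iff (s := a - c • s).1 ?_, evalAt_eq_zero_iff (s := b - c • t).1 ?_⟩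
    · rw [map_sub, map_smul, hs, hc, sub_self]
    · rw [map_sub, map_smul, ht, ← hab, hc, map_smul, sub_self]

/-- A side without sections has value zero at the node, and the gluing forces zero on the other
side. -/
theorem SeparatingNode.centerDim_eq_zero (C : SeparatingNode.{u} N) {k : ℕ}
    (h : H0 (C.bundleL' k) = ⊥ ∨ H0 (C.bundleR' k) = ⊥) : C.centerDim k = 0 := by
  refine finrank_quotient_comap_eq_zero fun x hx => ?_
  obtain ⟨a, b, hab, rfl⟩ := SeparatingNode.mem_base.1 hx
  have hzero : evalAt _ C.pL a = 0 ∧ evalAt _ C.pR b = 0 := by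
    rcases h with h | h
    · have ha : a = 0 := Subtype.ext ((Submodule.eq_bot_iff _).1 h a a.2)
      rw [ha, map_zero, map_zero] at hab
      exact ⟨by rw [ha, map_zero], hab.symm⟩
    · have hb : b = 0 := Subtype.ext ((Submodule.eq_bot_iff _).1 h b b.2)
      rw [hb, map_zero] at hab
      exact ⟨(LinearEquiv.map_eq_zero_iff _).1 hab, by rw [hb, map_zero]⟩
  exact ⟨evalAt_eq_zero_iff.1 hzero.1, evalAt_eq_zero_iff.1 hzero.2⟩

theorem NonseparatingNode.mem_base {C : NonseparatingNode.{u} N} {k : ℕ} {x : C.normalization.K} :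
    x ∈ C.base k ↔ ∃ a : H0 (C.bundle k),
      C.gluing k (evalAt (C.bundle k) C.q₁ a) = evalAt (C.bundle k) C.q₂ a ∧ (a : _) = x := by
  rw [NonseparatingNode.base, Submodule.mem_map]
  exact Iff.rfl

theorem NonseparatingNode.centerDim_eq_one (C : NonseparatingNode.{u} N) {k : ℕ}
    (h : Subsingleton (H1 (C.bundle k - C.q₁.divisor - C.q₂.divisor))) : C.centerDim k = 1 := by
  obtain ⟨e, he, hgen⟩ := exists_fiber_generator C.q₁ (C.bundle k C.q₁)
  obtain ⟨s, hs₁, hs₂⟩ := exists_evalAt_eq_and_evalAt_eq C.q_ne h e (C.gluing k e)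
  have hle : C.bundle k - C.q₁.divisor - C.q₂.divisor ≤ C.bundle k - C.q₁.divisor :=
    sub_divisor_le _ _
  refine finrank_quotient_comap_eq_one (w := (s : C.normalization.K))
    (NonseparatingNode.mem_base.2 ⟨s, by rw [hs₁, hs₂], rfl⟩) (fun h => he ?_) fun x hx => ?_
  · rw [← hs₁]
    exact evalAt_eq_zero_iff.2 (H0_mono hle h)
  · obtain ⟨a, ha, rfl⟩ := NonseparatingNode.mem_base.1 hx
    obtain ⟨c, hc⟩ := hgen (evalAt _ C.q₁ a)
    have h₁ : evalAt _ C.q₁ (a - c • s) = 0 := by rw [map_sub, map_smul, hs₁, hc, sub_self]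
    have h₂ : evalAt _ C.q₂ (a - c • s) = 0 := by
      rw [map_sub, map_smul, hs₂, ← ha, hc]
      exact sub_eq_zero.2 (LinearEquiv.map_smul (C.gluing k) c e)
    refine ⟨c, mem_H0.2 fun Q => ?_⟩
    rcases eq_or_ne Q C.q₂ with rfl | hQ
    · have := mem_H0.1 (evalAt_eq_zero_iff.1 h₂) C.q₂
      rw [sub_divisor_same] at this
      rwa [sub_divisor_same, sub_divisor_of_ne _ C.q_ne.symm]
    · rw [sub_divisor_of_ne _ hQ]
      exact mem_H0.1 (evalAt_eq_zero_iff.1 h₁) Q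

end CenterDim

/-! ### Degree estimates on the components. -/

section Degrees

variable {N : ℕ} (X : MarkedCurve.{u} N)

theorem MarkedCurve.degree_twistedBundle (E : Divisor X.K) (k : ℕ) :
    (X.twistedBundle E k).degree = k * (2 * (genus X.K : ℤ) - 2 + E.degree) +
      ∑ i, ((k : ℤ) - vanishingOrder (X.orbit i) k) := by
  have h1 : ∀ i, (X.point i).divisor.degree = 1 := fun i => Finsupp.degree_single _ _
  rw [MarkedCurve.twistedBundle, map_sub, map_nsmul, map_add, map_add, X.isCanonical.degree_eq,
    map_sum, map_sum, Finset.sum_sub_distrib]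
  simp only [map_nsmul, h1, nsmul_eq_mul, Finset.sum_const, mul_one]
  ring

theorem MarkedCurve.card_le_sum {k : ℕ} (hk : k ∈ Finset.Icc 2 N) :
    (Fintype.card X.ι : ℤ) ≤ ∑ i, ((k : ℤ) - vanishingOrder (X.orbit i) k) := by
  rw [Finset.mem_Icc] at hk
  have := Finset.card_nsmul_le_sum Finset.univ
    (fun i => (k : ℤ) - vanishingOrder (X.orbit i) k) 1 fun i _ => by
      have := vanishingOrder_lt (X.orbit_nonzero i) hk.1 hk.2
      omega
  rwa [nsmul_eq_mul, mul_one, Finset.card_univ] at this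

theorem Place.degree_divisor {F : Type u} [Field F] [Algebra ℂ F] (P : Place F) :
    P.divisor.degree = 1 := Finsupp.degree_single _ _

/-- The relevant degree is `2gk + ∑ (k - χ_k) - 2`. It exceeds `2g - 2` because `k ≥ 2` if `g > 0`,
and because stability gives a marked point if `g = 0`. -/
theorem NonseparatingNode.centerDim_ne_zero (C : NonseparatingNode.{u} N) {k : ℕ}
    (hk : k ∈ Finset.Icc 2 N) : C.centerDim k ≠ 0 := by
  rw [C.centerDim_eq_one]
  · exact one_ne_zero
  refine subsingleton_H1_of_degree C.normalization.isCanonical ?_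
  have hcard := C.normalization.card_le_sum hk
  have hst := C.stable
  rw [Finset.mem_Icc] at hk
  rw [NonseparatingNode.bundle, map_sub, map_sub, MarkedCurve.degree_twistedBundle, map_add,
    Place.degree_divisor, Place.degree_divisor]
  have hk2 : (2 : ℤ) ≤ k := by exact_mod_cast hk.1
  have hg : (0 : ℤ) ≤ genus C.normalization.K := Int.natCast_nonneg _
  have hn : (0 : ℤ) ≤ Fintype.card C.normalization.ι := Int.natCast_nonneg _
  rcases hg.eq_or_lt with h0 | h0
  · rw [← h0] at hst ⊢
    linarith
  · nlinarith

/-- The degree that decides the behaviour at a node with branch `p` on the component `X`: the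
degree of the bundle on a rational component; components of positive genus impose no condition. -/
def MarkedCurve.nodeDegree (p : Place X.K) (k : ℕ) : ℤ :=
  if genus X.K = 0 then (X.twistedBundle p.divisor k).degree else 0

theorem MarkedCurve.nodeDegree_of_genus_eq_zero (hg : genus X.K = 0) (p : Place X.K) :
    X.nodeDegree p = orbitDegree X.orbit := by
  funext k
  rw [MarkedCurve.nodeDegree, if_pos hg, X.degree_twistedBundle, hg, Place.degree_divisor,
    orbitDegree]
  push_cast
  ring

theorem MarkedCurve.subsingleton_H1_sub_divisor {p : Place X.K} {k : ℕ} (hk : k ∈ Finset.Icc 2 N)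
    (h : 0 ≤ X.nodeDegree p k) : Subsingleton (H1 (X.twistedBundle p.divisor k - p.divisor)) := by
  refine subsingleton_H1_of_degree X.isCanonical ?_
  rw [map_sub, Place.degree_divisor]
  by_cases hg : genus X.K = 0
  · rw [MarkedCurve.nodeDegree, if_pos hg] at h
    rw [hg]
    push_cast
    linarith
  · have hcard := X.card_le_sum hk
    have hn : (0 : ℤ) ≤ Fintype.card X.ι := Int.natCast_nonneg _
    rw [Finset.mem_Icc] at hk
    have hk2 : (2 : ℤ) ≤ k := by exact_mod_cast hk.1
    have hg1 : (1 : ℤ) ≤ genus X.K := by exact_mod_cast Nat.one_le_iff_ne_zero.2 hg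
    rw [X.degree_twistedBundle, Place.degree_divisor]
    nlinarith

theorem MarkedCurve.sInf_twist {p : Place X.K} {k : ℕ} (hk : k ∈ Finset.Icc 2 N) :
    sInf {n : ℕ | Subsingleton (H1 (X.twistedBundle p.divisor k + n • p.divisor))} =
      (-1 - X.nodeDegree p k).toNat := by
  rcases le_or_gt 0 (X.nodeDegree p k) with h | h
  · have h0 : 0 ∈ {n : ℕ | Subsingleton (H1 (X.twistedBundle p.divisor k + n • p.divisor))} := by
      rw [Set.mem_ofPred_eq, zero_smul, add_zero]
      exact subsingleton_H1_mono (sub_divisor_le _ _) (X.subsingleton_H1_sub_divisor hk h)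
    rw [Nat.sInf_eq_zero.2 (Or.inl h0)]
    omega
  · have hg : genus X.K = 0 := by
      by_contra hg
      rw [MarkedCurve.nodeDegree, if_neg hg] at h
      exact lt_irrefl _ h
    have hset : {n : ℕ | Subsingleton (H1 (X.twistedBundle p.divisor k + n • p.divisor))} =
        Set.Ici (-1 - X.nodeDegree p k).toNat := by
      ext n
      rw [Set.mem_ofPred_eq, subsingleton_H1_iff_of_genus_eq_zero X.isCanonical hg, map_add,
        degree_nsmul_divisor, Set.mem_Ici, MarkedCurve.nodeDegree, if_pos hg]
      omega
    rw [hset, csInf_Ici]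

variable (C : SeparatingNode.{u} N)

theorem SeparatingNode.nL_eq {k : ℕ} (hk : k ∈ Finset.Icc 2 N) :
    C.nL k = (-1 - C.left.nodeDegree C.pL k).toNat :=
  C.left.sInf_twist hk

theorem SeparatingNode.nR_eq {k : ℕ} (hk : k ∈ Finset.Icc 2 N) :
    C.nR k = (-1 - C.right.nodeDegree C.pR k).toNat :=
  C.right.sInf_twist hk

/-- The minimal twist raises a negative degree to exactly `-1`. The `(0 : ℕ)` stands for the twist
of the other component. -/
theorem MarkedCurve.H0_eq_bot_of_nodeDegree {p : Place X.K} {k : ℕ} (h : X.nodeDegree p k < 0) :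
    H0 (X.twistedBundle p.divisor k +
      (((-1 - X.nodeDegree p k).toNat : ℤ) - (0 : ℕ)) • p.divisor) = ⊥ := by
  apply H0_eq_bot
  have hg : genus X.K = 0 := by
    by_contra hg
    rw [MarkedCurve.nodeDegree, if_neg hg] at h
    exact lt_irrefl _ h
  rw [MarkedCurve.nodeDegree, if_pos hg] at h ⊢
  rw [map_add, map_zsmul, Place.degree_divisor, smul_eq_mul]
  omega

/-- The node parameter is present in degree `k` exactly when both node degrees are nonnegative. -/
theorem SeparatingNode.centerDim_eq {k : ℕ} (hk : k ∈ Finset.Icc 2 N)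
    (h : 0 ≤ C.left.nodeDegree C.pL k ∨ 0 ≤ C.right.nodeDegree C.pR k) :
    C.centerDim k =
      if 0 ≤ C.left.nodeDegree C.pL k ∧ 0 ≤ C.right.nodeDegree C.pR k then 1 else 0 := by
  have hnL := C.nL_eq hk
  have hnR := C.nR_eq hk
  split_ifs with hpos
  · have hL0 : C.nL k = 0 := by omega
    have hR0 : C.nR k = 0 := by omega
    refine C.centerDim_eq_one ?_ ?_
    · rw [SeparatingCurve.bundleL', hL0, hR0, sub_self, zero_smul, add_zero]
      exact C.left.subsingleton_H1_sub_divisor hk hpos.1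
    · rw [SeparatingCurve.bundleR', hL0, hR0, sub_self, zero_smul, add_zero]
      exact C.right.subsingleton_H1_sub_divisor hk hpos.2
  · refine C.centerDim_eq_zero ?_
    rcases lt_or_ge (C.left.nodeDegree C.pL k) 0 with hL | hL
    · have hR0 : C.nR k = 0 := by omega
      rw [SeparatingCurve.bundleL', hnL, hR0]
      exact Or.inl (C.left.H0_eq_bot_of_nodeDegree hL)
    · have hL0 : C.nL k = 0 := by omega
      rw [SeparatingCurve.bundleR', hnR, hL0]
      exact Or.inr (C.right.H0_eq_bot_of_nodeDegree (by
        by_contra! hR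
        exact hpos ⟨hL, hR⟩))

/-- The smooth curve is then rational too, and the sum is the degree of its `L_k`: each `-k` comes
from `k(-2 + 1)` on a component, together `-2k`. -/
theorem SeparatingNode.neg_one_le_add {H : MarkedCurve.{u} N} (hH : H.IsOK)
    (hC : C.IsDegenerationOf H) (hL : genus C.left.K = 0) (hR : genus C.right.K = 0) {k : ℕ}
    (hk : k ∈ Finset.Icc 2 N) :
    -1 ≤ C.left.nodeDegree C.pL k + C.right.nodeDegree C.pR k := by
  obtain ⟨hg, e, he⟩ := hC
  have hg0 : genus H.K = 0 := by omega
  have := (subsingleton_H1_iff_of_genus_eq_zero H.isCanonical hg0).1 (hH k hk)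
  rw [MarkedCurve.L, H.degree_twistedBundle, hg0, map_zero, ← e.symm.sum_comp,
    Fintype.sum_sum_type] at this
  simp only [he, Equiv.apply_symm_apply, Sum.elim_inl, Sum.elim_inr] at this
  rw [C.left.nodeDegree_of_genus_eq_zero hL, C.right.nodeDegree_of_genus_eq_zero hR, orbitDegree,
    orbitDegree]
  push_cast at this
  linarith

theorem MarkedCurve.exists_restrictedShape (p : Place X.K)
    (hst : 0 < 2 * (genus X.K : ℤ) - 2 + (Fintype.card X.ι + 1))
    (hneg : ∃ k ∈ Finset.Icc 2 N, X.nodeDegree p k < 0) :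
    genus X.K = 0 ∧ ∃ O t q, IsRestrictedShape N (X.nodeDegree p) O t q := by
  obtain ⟨k, hk, h⟩ := hneg
  have hg : genus X.K = 0 := by
    by_contra hg
    rw [MarkedCurve.nodeDegree, if_neg hg] at h
    exact lt_irrefl _ h
  rw [hg] at hst
  push_cast at hst
  rw [X.nodeDegree_of_genus_eq_zero hg] at h ⊢
  exact ⟨hg, TameHitchin.exists_restrictedShape (by omega) X.orbit_nonzero ⟨k, hk, h⟩⟩

end Degrees

end TameHitchin

end

noncomputable section

namespace TameHitchin

/-! ### Assembling the orbit from one or two restricting components. -/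

section Conclusion

variable {N : ℕ}

/-- The orbit at a restricted node with twists `n k` and graded dimensions `b k` of the center. -/
def HasNodeOrbit (N : ℕ) (n b : ℕ → ℕ) : Prop :=
  ∃ O : Nat.Partition N,
    (∀ k ∈ Finset.Icc 2 N, vanishingOrder O k = 1 + n k) ∧
    (∃ m ∈ Finset.Icc 2 N,
      (∀ k ∈ Finset.Icc 2 N, b k = if k ≤ m then 1 else 0) ∨
      (∀ k ∈ Finset.Icc 2 N, b k = if Even k ∧ k ≤ m then 1 else 0)) ∧
    2 * part O 1 ≤ part O 0 ∧
    (part O 0 : ℤ) - 2 ≤ 2 * ∑ k ∈ Finset.Icc 2 N, (b k : ℤ) ∧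
    2 * ∑ k ∈ Finset.Icc 2 N, (b k : ℤ) ≤ 2 * ((part O 0 : ℤ) - part O 1 - 1)

theorem sum_full {b : ℕ → ℕ} {m : ℕ} (h2 : 2 ≤ m) (hm : m ≤ N)
    (hb : ∀ k ∈ Finset.Icc 2 N, b k = if k ≤ m then 1 else 0) :
    ∑ k ∈ Finset.Icc 2 N, (b k : ℤ) = m - 1 := by
  rw [← Nat.cast_sum, Finset.sum_congr rfl hb, Finset.sum_boole,
    show (Finset.Icc 2 N).filter (· ≤ m) = Finset.Icc 2 m by ext k; simp; omega, Nat.card_Icc]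
  push_cast
  omega

theorem sum_alternating {b : ℕ → ℕ} {m : ℕ} (he : Even m) (hm : m ≤ N)
    (hb : ∀ k ∈ Finset.Icc 2 N, b k = if Even k ∧ k ≤ m then 1 else 0) :
    2 * ∑ k ∈ Finset.Icc 2 N, (b k : ℤ) = m := by
  obtain ⟨a, rfl⟩ := he
  have himage : (Finset.Icc 2 N).filter (fun k => Even k ∧ k ≤ a + a) =
      (Finset.Icc 1 a).image (fun i => 2 * i) := by
    ext k
    simp only [Finset.mem_filter, Finset.mem_Icc, Finset.mem_image]
    constructor
    · rintro ⟨h, ⟨c, rfl⟩, h'⟩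
      exact ⟨c, by omega, by omega⟩
    · rintro ⟨i, hi, rfl⟩
      exact ⟨by omega, even_two_mul i, by omega⟩
  rw [← Nat.cast_sum, Finset.sum_congr rfl hb, Finset.sum_boole, himage,
    Finset.card_image_of_injective _ (fun x y h => by simpa using h), Nat.card_Icc]
  push_cast
  omega

/-- Here `p₁ = t + q` and `p₂ ≤ q ≤ t`. The sum of the `b_k` is `t - 1` in the full form and `t / 2`
in the alternating form; the bounds in (C) then use `q ≤ t` and `q ≤ 2` respectively. -/
theorem IsRestrictedShape.hasNodeOrbit {d : ℕ → ℤ} {O : Nat.Partition N} {t q : ℕ}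
    (h : IsRestrictedShape N d O t q) {n b : ℕ → ℕ}
    (hn : ∀ k ∈ Finset.Icc 2 N, n k = (-1 - d k).toNat)
    (hb : ∀ k ∈ Finset.Icc 2 N, b k = if 0 ≤ d k then 1 else 0) : HasNodeOrbit N n b := by
  obtain ⟨ht2, htN, h0, h1, hqt, hχ, hI | hII⟩ := h
  · obtain ⟨-, -, hd⟩ := hI
    have hb' : ∀ k ∈ Finset.Icc 2 N, b k = if k ≤ t then 1 else 0 := fun k hk => by
      simp only [hb k hk, hd k hk]
    refine ⟨O, fun k hk => by rw [hχ k hk, hn k hk],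
      ⟨t, Finset.mem_Icc.2 ⟨ht2, htN⟩, Or.inl hb'⟩, by omega, ?_, ?_⟩ <;>
    · rw [sum_full ht2 htN hb']
      omega
  · obtain ⟨he, hq, hd⟩ := hII
    have hb' : ∀ k ∈ Finset.Icc 2 N, b k = if Even k ∧ k ≤ t then 1 else 0 := fun k hk => by
      simp only [hb k hk, hd k hk]
    refine ⟨O, fun k hk => by rw [hχ k hk, hn k hk],
      ⟨t, Finset.mem_Icc.2 ⟨ht2, htN⟩, Or.inr hb'⟩, by omega, ?_, ?_⟩ <;>
    · rw [sum_alternating he htN hb']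
      omega

theorem vanishingOrder_le_one {O : Nat.Partition N} (h : N ≤ part O 0) {k : ℕ} (hk : k ≤ N) :
    vanishingOrder O k ≤ 1 := by
  rw [vanishingOrder_le_iff O hk, partSum, Finset.sum_range_one]
  omega

/-- Both components restrict the node, one of them only in the top degree. -/
theorem hasNodeOrbit_of_mixed {d d' : ℕ → ℤ} {O O' : Nat.Partition N} {t q t' q' : ℕ}
    (h : IsRestrictedShape N d O t q) (h' : IsRestrictedShape N d' O' t' q')
    (hI : t < N ∧ 1 ≤ q ∧ ∀ k ∈ Finset.Icc 2 N, 0 ≤ d k ↔ k ≤ t)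
    (hII : Even t' ∧ q' ≤ 2 ∧ ∀ k ∈ Finset.Icc 2 N, 0 ≤ d' k ↔ Even k ∧ k ≤ t')
    (hdd : ∀ k ∈ Finset.Icc 2 N, -1 ≤ d k + d' k) {n b : ℕ → ℕ}
    (hn : ∀ k ∈ Finset.Icc 2 N, n k = (-1 - d k).toNat + (-1 - d' k).toNat)
    (hb : ∀ k ∈ Finset.Icc 2 N, b k = if 0 ≤ d k ∧ 0 ≤ d' k then 1 else 0) :
    HasNodeOrbit N n b := by
  obtain ⟨ht2, -, h0, -, -, hχ, -⟩ := h
  obtain ⟨-, htN', h0', h1', -, hχ', -⟩ := h'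
  obtain ⟨htN, hq, hd⟩ := hI
  obtain ⟨he', -, hd'⟩ := hII
  have hmemN : N ∈ Finset.Icc 2 N := Finset.mem_Icc.2 ⟨by omega, le_rfl⟩
  have hmemN1 : N - 1 ∈ Finset.Icc 2 N := Finset.mem_Icc.2 ⟨by omega, by omega⟩
  -- In degree `N` the first side is negative, so the second is not, and `N` is even. In the odd
  -- degree `N - 1` the second side is negative, so the first is not, which pins `t` to `N - 1`.
  have hN : Even N ∧ N ≤ t' := by
    rw [← hd' N hmemN]
    have h1 := hdd N hmemN
    have h2 := hd N hmemN
    omega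
  have hodd : ¬ Even (N - 1) := by
    have := hN.1
    rw [Nat.even_iff] at this ⊢
    omega
  have ht : t = N - 1 := by
    have h1 := hdd _ hmemN1
    have h2 := hd _ hmemN1
    have h3 := (hd' _ hmemN1).not.2 (fun h => hodd h.1)
    omega
  have hsum : part O' 0 + part O' 1 ≤ N := by
    have := partSum_le O' 2
    rwa [partSum, Finset.sum_range_succ, Finset.sum_range_one] at this
  have hb' : ∀ k ∈ Finset.Icc 2 N, b k = if Even k ∧ k ≤ N - 2 then 1 else 0 := fun k hk => by
    rw [hb k hk]
    refine if_congr ?_ rfl rfl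
    rw [hd k hk, hd' k hk]
    rw [Finset.mem_Icc] at hk
    have := hN.1
    rw [Nat.even_iff] at *
    omega
  have heven : Even (N - 2) := by
    have := hN.1
    rw [Nat.even_iff] at this ⊢
    omega
  have hN4 : 4 ≤ N := by
    have := hN.1
    rw [Nat.even_iff] at this
    omega
  -- Both `t + q` and `t' + q'` are at least `N`, so both orbits are the single block and neither
  -- side is twisted. Either orbit would do.
  refine ⟨O', fun k hk => ?_, ⟨N - 2, Finset.mem_Icc.2 ⟨by omega, by omega⟩, Or.inr hb'⟩,
    by omega, ?_, ?_⟩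
  · have hkN := (Finset.mem_Icc.1 hk).2
    have h1 := vanishingOrder_le_one (O := O) (by omega) hkN
    have h2 := hχ k hk
    have h3 := hχ' k hk
    have h4 := hn k hk
    omega
  all_goals
    rw [sum_alternating heven (by omega) hb']
    omega

theorem hasNodeOrbit_of_degrees {d d' : ℕ → ℤ} {n b : ℕ → ℕ}
    (hd : (∃ k ∈ Finset.Icc 2 N, d k < 0) → ∃ O t q, IsRestrictedShape N d O t q)
    (hd' : (∃ k ∈ Finset.Icc 2 N, d' k < 0) → ∃ O t q, IsRestrictedShape N d' O t q)
    (hdd : (∃ k ∈ Finset.Icc 2 N, d k < 0) → (∃ k ∈ Finset.Icc 2 N, d' k < 0) →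
      ∀ k ∈ Finset.Icc 2 N, -1 ≤ d k + d' k)
    (hn : ∀ k ∈ Finset.Icc 2 N, n k = (-1 - d k).toNat + (-1 - d' k).toNat)
    (hb : ∀ k ∈ Finset.Icc 2 N, b k = if 0 ≤ d k ∧ 0 ≤ d' k then 1 else 0)
    (hR : ∃ k ∈ Finset.Icc 2 N, b k = 0) : HasNodeOrbit N n b := by
  by_cases h : ∃ k ∈ Finset.Icc 2 N, d k < 0
  · obtain ⟨O, t, q, hO⟩ := hd h
    by_cases h' : ∃ k ∈ Finset.Icc 2 N, d' k < 0
    · obtain ⟨O', t', q', hO'⟩ := hd' h'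
      have hdd' := hdd h h'
      have hN2 : 2 ≤ N := hO.1.trans hO.2.1
      have hmemN : N ∈ Finset.Icc 2 N := Finset.mem_Icc.2 ⟨hN2, le_rfl⟩
      rcases hO.2.2.2.2.2.2 with hI | hII <;> rcases hO'.2.2.2.2.2.2 with hI' | hII'
      -- Both degrees are negative in degree `N`, so their sum is at most `-2`.
      · have h1 := (hI.2.2 N hmemN).not.2 (by omega)
        have h2 := (hI'.2.2 N hmemN).not.2 (by omega)
        have h3 := hdd' N hmemN
        omega
      · exact hasNodeOrbit_of_mixed hO hO' hI hII' hdd' hn hb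
      · exact hasNodeOrbit_of_mixed hO' hO hI' hII (fun k hk => by rw [add_comm]; exact hdd' k hk)
          (fun k hk => by rw [hn k hk, add_comm]) (fun k hk => by rw [hb k hk]; simp only [and_comm])
      -- Two alternating sides are both negative in degree `3`. This degree exists: the shape makes
      -- degree `2` nonnegative, so a negative one needs `N ≥ 3`.
      · have hN3 : 3 ≤ N := by
          obtain ⟨k, hk, hlt⟩ := h
          by_contra! hcon
          rw [Finset.mem_Icc] at hk
          obtain rfl : k = 2 := by omega
          have := (hII.2.2 2 (Finset.mem_Icc.2 hk)).2 ⟨even_two, hO.1⟩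
          omega
        have hmem3 : 3 ∈ Finset.Icc 2 N := Finset.mem_Icc.2 ⟨by omega, hN3⟩
        have hodd : ¬ Even 3 := by decide
        have h1 := (hII.2.2 3 hmem3).not.2 (fun h => hodd h.1)
        have h2 := (hII'.2.2 3 hmem3).not.2 (fun h => hodd h.1)
        have h3 := hdd' 3 hmem3
        omega
    · push Not at h'
      refine hO.hasNodeOrbit (fun k hk => ?_) fun k hk => ?_
      · have := h' k hk
        rw [hn k hk]
        omega
      · simp [hb k hk, h' k hk]
  · push Not at h
    obtain ⟨k, hk, hk0⟩ := hR
    have h' : ∃ k ∈ Finset.Icc 2 N, d' k < 0 := by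
      refine ⟨k, hk, ?_⟩
      by_contra! hcon
      simp [hb k hk, h k hk, hcon] at hk0
    obtain ⟨O', t', q', hO'⟩ := hd' h'
    refine hO'.hasNodeOrbit (fun k hk => ?_) fun k hk => ?_
    · have := h k hk
      rw [hn k hk]
      omega
    · simp [hb k hk, h k hk]

theorem SeparatingNode.hasNodeOrbit (C : SeparatingNode.{u} N) {H : MarkedCurve.{u} N}
    (hH : H.IsOK) (hC : C.IsDegenerationOf H) (hR : ∃ k ∈ Finset.Icc 2 N, C.centerDim k = 0) :
    HasNodeOrbit N C.twist C.centerDim := by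
  have hL := C.left.exists_restrictedShape C.pL C.left_stable
  have hR' := C.right.exists_restrictedShape C.pR C.right_stable
  refine hasNodeOrbit_of_degrees (fun h => (hL h).2) (fun h => (hR' h).2)
    (fun h h' k hk => C.neg_one_le_add hH hC (hL h).1 (hR' h').1 hk)
    (fun k hk => by rw [SeparatingNode.twist, C.nL_eq hk, C.nR_eq hk]) (fun k hk => ?_) hR
  refine C.centerDim_eq hk ?_
  by_contra! hcon
  have := C.neg_one_le_add hH hC (hL ⟨k, hk, hcon.1⟩).1 (hR' ⟨k, hk, hcon.2⟩).1 hk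
  omega

end Conclusion

end TameHitchin

end
theorem theorem6p1 {N : ℕ} (H : TameHitchin.MarkedCurve.{u} N) (hH : H.IsOK)
    (C : TameHitchin.Node.{u} N) (hC : C.IsDegenerationOf H) (hR : C.IsRestricted) :
    ∃ O : Nat.Partition N,
      -- (A)
      (∀ k ∈ Finset.Icc 2 N, TameHitchin.vanishingOrder O k = 1 + C.twist k) ∧
      -- (B)
      (∃ m ∈ Finset.Icc 2 N,
        (∀ k ∈ Finset.Icc 2 N, C.centerDim k = if k ≤ m then 1 else 0) ∨
        (∀ k ∈ Finset.Icc 2 N, C.centerDim k = if Even k ∧ k ≤ m then 1 else 0)) ∧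
      -- (C)
      2 * TameHitchin.part O 1 ≤ TameHitchin.part O 0 ∧
      (TameHitchin.part O 0 : ℤ) - 2 ≤ 2 * ∑ k ∈ Finset.Icc 2 N, (C.centerDim k : ℤ) ∧
      2 * ∑ k ∈ Finset.Icc 2 N, (C.centerDim k : ℤ) ≤
        2 * ((TameHitchin.part O 0 : ℤ) - TameHitchin.part O 1 - 1) := by
  cases C with
  | separating C => exact C.hasNodeOrbit hH hC hR
  | nonseparating C =>
    obtain ⟨k, hk, h⟩ := hR
    exact absurd h (C.centerDim_ne_zero hk)
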